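/- Let $\mathcal G$ be the set of quantum gates consisting of all $1$-qubit unitary gates and the $2$-qubit gate $\mathrm{CSIGN}=\mathrm{diag}(1,1,1,-1)$. Let $C$ range over classical circuits with $n$ input bits, built from fan-in-two AND and OR gates, NOT gates and constant gates, and let $|C|$ be the number of gates of $C$. Such a circuit computes a function $C:\{0,1\}^n\to\{-1,1\}$, where the output bit $0$ stands for $1$ and the output bit $1$ stands for $-1$. Put $\Delta_C:=\sum_{x\in\{0,1\}^n}C(x)$. There exists a deterministic classical algorithm (a multi-stack Turing machine) that takes a circuit $C$ as input, runs in $\mathrm{poly}(n,|C|)$ time, and outputs a description of a qubit circuit $Q$, on some number $k$ of qubits and consisting of gates from $\mathcal G$, such that \[ \langle 0\cdots 0|\,Q\,|0\cdots 0\rangle=\frac{\Delta_C}{2^n}. \] Moreover, the $1$-qubit gates that occur in the output circuits are all taken from one fixed finite set, namely $\{H,X,Z,T,T^{-1},B,B^{-1}\}$, where $H=\frac1{\sqrt2}\begin{pmatrix}1&1\\1&-1\end{pmatrix}$, $X=\begin{pmatrix}0&1\\1&0\end{pmatrix}$, $Z=\mathrm{diag}(1,-1)$, $T=\mathrm{diag}(1,e^{i\pi/4})$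 and $B=\frac12\begin{pmatrix}\sqrt{2+\sqrt2}&i\sqrt{2-\sqrt2}\\ i\sqrt{2-\sqrt2}&\sqrt{2+\sqrt2}\end{pmatrix}$. -/

import Mathlib

/-! ### Classical circuits -/

/-- A gate of a classical circuit of fan-in at most two; wires are named by natural numbers. -/
inductive BoolGate where
  | const (b : Bool)
  | not (a : ℕ)
  | and (a b : ℕ)
  | or (a b : ℕ)
  deriving DecidableEq

/-- The wires that a gate reads. -/
def BoolGate.inputs : BoolGate → List ℕ
  | .const _ => []
  | .not a => [a]
  | .and a b => [a, b]
  | .or a b => [a, b]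

/-- The value of a gate, when `v` lists the values of the wires `0, 1, 2, …` computed so far. -/
def BoolGate.eval (v : List Bool) : BoolGate → Bool
  | .const b => b
  | .not a => !(v.getD a false)
  | .and a b => v.getD a false && v.getD b false
  | .or a b => v.getD a false || v.getD b false

/-- A classical circuit on `n` input bits. The wires `0, …, n - 1` are the inputs, and wire `n + i`
carries the value of the `i`-th gate, which may read only wires that precede it.
One of the wires is the output. -/
@[ext]
structure BoolCircuit (n : ℕ) where
  gates : List BoolGate
  output : ℕ
  gates_wf : ∀ (i : ℕ) (h : i < gates.length), ∀ a ∈ (gates[i]'h).inputs, a < n + i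
  output_wf : output < n + gates.length

/-- `|C|`, the number of gates. -/
def BoolCircuit.size {n : ℕ} (C : BoolCircuit n) : ℕ := C.gates.length

/-- The values of all the wires, on input `x`. -/
def BoolCircuit.wires {n : ℕ} (C : BoolCircuit n) (x : Fin n → Bool) : List Bool :=
  C.gates.foldl (fun v g => v ++ [g.eval v]) (List.ofFn x)

/-- The output bit, on input `x`. -/
def BoolCircuit.bit {n : ℕ} (C : BoolCircuit n) (x : Fin n → Bool) : Bool :=
  (C.wires x).getD C.output false

/-- The function `C : {0,1}ⁿ → {-1,1}`: output bit `0` means `1` and output bit `1` means `-1`. -/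
def BoolCircuit.sign {n : ℕ} (C : BoolCircuit n) (x : Fin n → Bool) : ℤ :=
  if C.bit x then -1 else 1

/-- `Δ_C = ∑ₓ C(x)`. -/
def BoolCircuit.delta {n : ℕ} (C : BoolCircuit n) : ℤ := ∑ x : Fin n → Bool, C.sign x

/-! ### Quantum circuits over the 1-qubit gates and CSIGN -/

/-- A gate applied to specified qubits among `k`: a 1-qubit gate taken from `G`, or CSIGN on two
distinct qubits. -/
inductive QGate (G : Type) (k : ℕ) where
  | one (u : G) (q : Fin k)
  | csign (a b : Fin k) (h : a ≠ b)

/-- Replace every 1-qubit gate `u` by `f u`. -/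
def QGate.map {G G' : Type} (f : G → G') {k : ℕ} : QGate G k → QGate G' k
  | .one u q => .one (f u) q
  | .csign a b h => .csign a b h

/-- The `2ᵏ × 2ᵏ` matrix of a gate, in the computational basis: a 1-qubit gate is tensored with the
identity on the other qubits, and CSIGN flips the sign if both of its qubits are `1`. -/
noncomputable def QGate.matrix {k : ℕ} :
    QGate (Matrix.unitaryGroup (Fin 2) ℂ) k → Matrix (Fin k → Fin 2) (Fin k → Fin 2) ℂ
  | .one u q => Matrix.of fun y x => if ∀ j, j ≠ q → y j = x j then u.1 (y q) (x q) else 0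
  | .csign a b _ => Matrix.diagonal fun x => if x a = 1 ∧ x b = 1 then -1 else 1

/-- A quantum circuit on `k` qubits whose gates are CSIGN and arbitrary 1-qubit unitaries;
the first gate of the list is applied first. -/
abbrev QCircuit (k : ℕ) : Type := List (QGate (Matrix.unitaryGroup (Fin 2) ℂ) k)

/-- The transformation induced by a quantum circuit. -/
noncomputable def QCircuit.matrix {k : ℕ} :
    QCircuit k → Matrix (Fin k → Fin 2) (Fin k → Fin 2) ℂ
  | [] => 1
  | g :: Q => QCircuit.matrix Q * g.matrix

/-- The amplitude `⟨0⋯0|Q|0⋯0⟩`. -/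
noncomputable def QCircuit.amplitude {k : ℕ} (Q : QCircuit k) : ℂ :=
  QCircuit.matrix Q (fun _ => 0) (fun _ => 0)

/-! ### Named 1-qubit gates: what a classical algorithm can write down -/

/-- The Hadamard gate `H`. -/
noncomputable def hadamardGate : Matrix.unitaryGroup (Fin 2) ℂ :=
  ⟨!![1 / (√2 : ℝ), 1 / (√2 : ℝ); 1 / (√2 : ℝ), -1 / (√2 : ℝ)], by
    have h : ((√2 : ℝ) : ℂ) * (√2 : ℝ) = 2 := by
      rw [← Complex.ofReal_mul, Real.mul_self_sqrt (by norm_num)]; norm_num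
    have h0 : ((√2 : ℝ) : ℂ) ≠ 0 := by
      intro h0; rw [h0] at h; norm_num at h
    rw [Matrix.mem_unitaryGroup_iff]
    ext i j
    fin_cases i <;> fin_cases j <;>
      simp [Matrix.mul_apply, Matrix.star_apply, Fin.sum_univ_two] <;> field_simp <;>
      first | ring1 | linear_combination h | linear_combination (-1 : ℂ) * h⟩

/-- The diagonal gate with entries `1` and `e^{iθ}`. -/
noncomputable def phaseGate (θ : ℝ) : Matrix.unitaryGroup (Fin 2) ℂ :=
  ⟨!![1, 0; 0, Complex.exp (θ * Complex.I)], by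
    rw [Matrix.mem_unitaryGroup_iff]
    ext i j
    fin_cases i <;> fin_cases j <;>
      simp [Matrix.mul_apply, Matrix.star_apply, Fin.sum_univ_two, ← Complex.exp_conj,
        ← Complex.exp_add]⟩

/-- The NOT gate `X`. -/
noncomputable def notGate : Matrix.unitaryGroup (Fin 2) ℂ :=
  ⟨!![0, 1; 1, 0], by
    rw [Matrix.mem_unitaryGroup_iff]
    ext i j
    fin_cases i <;> fin_cases j <;>
      simp [Matrix.mul_apply, Matrix.star_apply, Fin.sum_univ_two]⟩

/-- The gate `B`, with `√(2+√2)/2` on the diagonal and `i√(2-√2)/2` off it. -/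
noncomputable def bGate : Matrix.unitaryGroup (Fin 2) ℂ :=
  ⟨!![(√(2 + √2) / 2 : ℝ), Complex.I * (√(2 - √2) / 2 : ℝ);
      Complex.I * (√(2 - √2) / 2 : ℝ), (√(2 + √2) / 2 : ℝ)], by
    have hs : √(2 : ℝ) ≤ 2 := by
      rw [Real.sqrt_le_left (by norm_num)]; norm_num
    have h1 : ((√(2 + √2) : ℝ) : ℂ) * (√(2 + √2) : ℝ) = 2 + (√2 : ℝ) := by
      rw [← Complex.ofReal_mul, Real.mul_self_sqrt (by positivity)]; push_cast; rfl
    have h2 : ((√(2 - √2) : ℝ) : ℂ) * (√(2 - √2) : ℝ) = 2 - (√2 : ℝ) := by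
      rw [← Complex.ofReal_mul, Real.mul_self_sqrt (by linarith)]; push_cast; rfl
    have hI : Complex.I * Complex.I = -1 := Complex.I_mul_I
    rw [Matrix.mem_unitaryGroup_iff]
    ext i j
    fin_cases i <;> fin_cases j <;>
      simp [Matrix.mul_apply, Matrix.star_apply, Fin.sum_univ_two, Complex.conj_ofNat] <;>
      first
      | ring1
      | linear_combination (1 / 4 : ℂ) * h1 + (1 / 4 : ℂ) * h2
          - (1 / 4 : ℂ) * ((√(2 - √2) : ℝ) : ℂ) * (√(2 - √2) : ℝ) * hI⟩

/-- Names of finitely many 1-qubit gates: `H`, `X`, `Z`, `T`, `T⁻¹`, `B`, `B⁻¹`. -/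
inductive GateName where
  | H
  | X
  | Z
  | T
  | Tinv
  | B
  | Binv
  deriving DecidableEq

instance : Fintype GateName :=
  ⟨{.H, .X, .Z, .T, .Tinv, .B, .Binv}, by intro u; cases u <;> decide⟩

/-- The 1-qubit gate with a given name. -/
noncomputable def GateName.gate : GateName → Matrix.unitaryGroup (Fin 2) ℂ
  | .H => hadamardGate
  | .X => notGate
  | .Z => phaseGate Real.pi
  | .T => phaseGate (Real.pi / 4)
  | .Tinv => (phaseGate (Real.pi / 4))⁻¹
  | .B => bGate
  | .Binv => bGate⁻¹

/-- A finite description of a quantum circuit: the number of qubits, and a list of gates, each of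
which is CSIGN or a named 1-qubit gate. -/
structure QProgram where
  qubits : ℕ
  gates : List (QGate GateName qubits)

/-- The quantum circuit that is described. -/
noncomputable def QProgram.circuit (P : QProgram) : QCircuit P.qubits :=
  P.gates.map (QGate.map GateName.gate)

/-! ### Encodings as strings over finite alphabets -/

/-- The alphabet for classical circuits. -/
inductive CircuitSymbol where
  | tick
  | sep
  | const (b : Bool)
  | not
  | and
  | or
  | out
  deriving DecidableEq, Fintype

/-- The unary numeral of `a`, followed by a separator. -/
def CircuitSymbol.unary (a : ℕ) : List CircuitSymbol := List.replicate a .tick ++ [.sep]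

/-- A gate is written as its kind, followed by the wires that it reads. -/
def BoolGate.encode : BoolGate → List CircuitSymbol
  | .const b => [.const b]
  | .not a => .not :: CircuitSymbol.unary a
  | .and a b => .and :: (CircuitSymbol.unary a ++ CircuitSymbol.unary b)
  | .or a b => .or :: (CircuitSymbol.unary a ++ CircuitSymbol.unary b)

/-- A classical circuit is written as `n`, the gates in order, and the output wire. All numbers that
occur are at most `n + |C|`, so that unary notation keeps the length polynomial in `n` and `|C|`. -/
def BoolCircuit.encode {n : ℕ} (C : BoolCircuit n) : List CircuitSymbol :=
  CircuitSymbol.unary n ++ (C.gates.flatMap BoolGate.encode ++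
    .out :: CircuitSymbol.unary C.output)

/-- The alphabet for quantum circuits. -/
inductive ProgramSymbol where
  | tick
  | sep
  | one (u : GateName)
  | csign
  deriving DecidableEq, Fintype

/-- The unary numeral of `a`, followed by a separator. -/
def ProgramSymbol.unary (a : ℕ) : List ProgramSymbol := List.replicate a .tick ++ [.sep]

/-- A gate is written as its kind, followed by the qubits that it acts on. -/
def QGate.encode {k : ℕ} : QGate GateName k → List ProgramSymbol
  | .one u q => .one u :: ProgramSymbol.unary q
  | .csign a b _ => .csign :: (ProgramSymbol.unary a ++ ProgramSymbol.unary b)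

/-- A quantum circuit is written as its number of qubits, followed by its gates in order. -/
def QProgram.encode (P : QProgram) : List ProgramSymbol :=
  ProgramSymbol.unary P.qubits ++ P.gates.flatMap QGate.encode

/-! The circuit is the phase-query interferometer. Hadamard gates turn the zero state into φ =
2^(-n/2) ∑ₓ |x⟩. The wires of `C` are then computed one by one into fresh qubits, `Z` is applied to
the output qubit, and the computation is undone. On the states that store an input this multiplies
|x⟩ by C(x) (`query_mulVec`). The closing Hadamard gates pair the result with φ again, and
orthonormality of the basis states leaves 2^(-n) ∑ₓ C(x) (`compile_amplitude`).

Each classical gate becomes a block that adds its value, a polynomial over the field with two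
elements, to the target qubit. Such a block is its own inverse on the states that occur, so the same
blocks in reverse order undo the computation. The only nonlinear ingredient is the Toffoli gate,
made exactly from `T`, `T⁻¹`, `H` and CSIGN (`isDiagonal_ccsign`). The gates `B` and `B⁻¹` are never
needed.

For the algorithm, a small imperative language with a cost semantics `Runs` is translated to a stack
machine without loss of time (`Runs.exec`). Output is a stack, so the circuit is written from its
last gate to its first. Since it is palindromic at the level of blocks, one forward pass over the
classical gates writes the uncomputation while moving them to a second stack, and one backward pass
writes the computation (`runs_forwardPass`, `runs_backwardPass`). Numerals are unary, so each gate
costs linear time and the whole run is quadratic (`runs_compiler`). -/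

/-! ### Circuits over named qubits -/

/-- A gate whose qubits are named by elements of `V`. -/
inductive WireGate (V : Type) where
  | one (u : GateName) (q : V)
  | csign (a b : V)

namespace WireGate

variable {V W : Type}

/-- Rename the qubits. -/
def map (f : V → W) : WireGate V → WireGate W
  | .one u q => .one u (f q)
  | .csign a b => .csign (f a) (f b)

/-- The gates on `k` qubits; a CSIGN whose qubits coincide is dropped. -/
def toQGates {k : ℕ} : WireGate (Fin k) → List (QGate GateName k)
  | .one u q => [.one u q]
  | .csign a b => if h : a ≠ b then [.csign a b h] else []

/-- CNOT. -/
def cnot (c t : V) : List (WireGate V) := [.one .H t, .csign c t, .one .H t]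

/-- The doubly controlled sign: the phase `(-1)^{abc}` is the product of eighth roots of unity
given by the parities of the subsets of `{a, b, c}`. -/
def ccsign (a b c : V) : List (WireGate V) :=
  [.one .T a] ++ ([.one .T b] ++ ([.one .T c] ++
    ((cnot b c ++ ([.one .Tinv c] ++ cnot b c)) ++
    ((cnot a c ++ ([.one .Tinv c] ++ cnot a c)) ++
    ((cnot a b ++ ([.one .Tinv b] ++ cnot a b)) ++
    (cnot a c ++ ((cnot b c ++ ([.one .T c] ++ cnot b c)) ++ cnot a c)))))))

/-- The Toffoli gate. -/
def toffoli (a b t : V) : List (WireGate V) := [.one .H t] ++ (ccsign a b t ++ [.one .H t])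

/-- Add `a * b` to `t`, with the help of the scratch qubit `s`; here `a = b` is allowed. -/
def addMul (s a b t : V) : List (WireGate V) := cnot a s ++ (toffoli s b t ++ cnot a s)

end WireGate

open WireGate

/-- The transformation induced by a list of gates. -/
noncomputable def circuitMatrix {k : ℕ} (L : List (WireGate (Fin k))) :
    Matrix (Fin k → Fin 2) (Fin k → Fin 2) ℂ :=
  QCircuit.matrix ((L.flatMap toQGates).map (QGate.map GateName.gate))

/-- A computational basis vector. -/
noncomputable def ket {k : ℕ} (x : Fin k → Fin 2) : (Fin k → Fin 2) → ℂ := Pi.single x 1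

theorem QCircuit.matrix_append {k : ℕ} (L L' : QCircuit k) :
    QCircuit.matrix (L ++ L') = QCircuit.matrix L' * QCircuit.matrix L := by
  induction L with
  | nil => simp [QCircuit.matrix]
  | cons g L ih => simp [QCircuit.matrix, ih, Matrix.mul_assoc]

/-! ### Action of the gates on basis vectors, and the Toffoli gate. -/

section Action

variable {k : ℕ}

open Matrix Function

theorem circuitMatrix_nil : circuitMatrix ([] : List (WireGate (Fin k))) = 1 := rfl

theorem circuitMatrix_append (L L' : List (WireGate (Fin k))) :
    circuitMatrix (L ++ L') = circuitMatrix L' * circuitMatrix L := by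
  simp [circuitMatrix, QCircuit.matrix_append]

theorem circuitMatrix_append_mulVec (L L' : List (WireGate (Fin k)))
    (v : (Fin k → Fin 2) → ℂ) :
    circuitMatrix (L ++ L') *ᵥ v = circuitMatrix L' *ᵥ (circuitMatrix L *ᵥ v) := by
  rw [circuitMatrix_append, Matrix.mulVec_mulVec]

theorem circuitMatrix_one (u : GateName) (q : Fin k) :
    circuitMatrix [.one u q] = (QGate.one u.gate q).matrix := by
  simp [circuitMatrix, toQGates, QGate.map, QCircuit.matrix]

theorem circuitMatrix_one_mulVec (u : GateName) (q : Fin k) (x : Fin k → Fin 2) :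
    circuitMatrix [.one u q] *ᵥ ket x =
      u.gate.1 0 (x q) • ket (update x q 0) + u.gate.1 1 (x q) • ket (update x q 1) := by
  rw [circuitMatrix_one]
  ext y
  have key : ∀ b, y = update x q b ↔ (y q = b ∧ ∀ j, j ≠ q → y j = x j) := by
    intro b
    rw [eq_update_iff]
  simp only [ket, Matrix.mulVec_single_one, Matrix.col_apply, QGate.matrix, Matrix.of_apply,
    Pi.add_apply, Pi.smul_apply, Pi.single_apply, key, smul_eq_mul]
  by_cases h : ∀ j, j ≠ q → y j = x j
  · have hq : y q = 0 ∨ y q = 1 := by generalize y q = b; revert b; decide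
    rcases hq with hq | hq <;> simp [hq]
  · simp [h]

theorem circuitMatrix_csign_mulVec {a b : Fin k} (h : a ≠ b) (x : Fin k → Fin 2) :
    circuitMatrix [.csign a b] *ᵥ ket x =
      (if x a = 1 ∧ x b = 1 then -1 else 1 : ℂ) • ket x := by
  have : circuitMatrix [.csign a b] = (QGate.csign (G := unitaryGroup (Fin 2) ℂ) a b h).matrix := by
    simp [circuitMatrix, toQGates, QGate.map, QCircuit.matrix, h]
  rw [this]
  ext y
  simp only [ket, QGate.matrix, Matrix.mulVec_diagonal, Pi.smul_apply, Pi.single_apply, smul_eq_mul]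
  by_cases hy : y = x <;> simp [hy]

/-- `L` multiplies every basis vector by a phase. -/
def IsDiagonal (L : List (WireGate (Fin k))) (d : (Fin k → Fin 2) → ℂ) : Prop :=
  ∀ x, circuitMatrix L *ᵥ ket x = d x • ket x

/-- `L` maps basis vectors to basis vectors. -/
def IsPermutation (L : List (WireGate (Fin k))) (f : (Fin k → Fin 2) → (Fin k → Fin 2)) : Prop :=
  ∀ x, circuitMatrix L *ᵥ ket x = ket (f x)

theorem IsDiagonal.append {L L' : List (WireGate (Fin k))} {d d' : (Fin k → Fin 2) → ℂ}
    (h : IsDiagonal L d) (h' : IsDiagonal L' d') : IsDiagonal (L ++ L') fun x => d x * d' x := by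
  intro x
  rw [circuitMatrix_append_mulVec, h, Matrix.mulVec_smul, h', smul_smul]

theorem IsPermutation.append {L L' : List (WireGate (Fin k))}
    {f f' : (Fin k → Fin 2) → (Fin k → Fin 2)}
    (h : IsPermutation L f) (h' : IsPermutation L' f') :
    IsPermutation (L ++ L') fun x => f' (f x) := by
  intro x
  rw [circuitMatrix_append_mulVec, h, h']

/-- This gives phases that depend on parities: CNOTs put a parity into one qubit, a phase is applied
there, and the CNOTs are undone. -/
theorem IsDiagonal.conj {L P P' : List (WireGate (Fin k))} {d : (Fin k → Fin 2) → ℂ}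
    {f f' : (Fin k → Fin 2) → (Fin k → Fin 2)} (h : IsDiagonal L d) (hP : IsPermutation P f)
    (hP' : IsPermutation P' f') (hf : ∀ x, f' (f x) = x) :
    IsDiagonal (P ++ (L ++ P')) fun x => d (f x) := by
  intro x
  rw [circuitMatrix_append_mulVec, circuitMatrix_append_mulVec, hP, h, Matrix.mulVec_smul, hP', hf]

/-- The eighth root of unity `e^{iπ/4}`. -/
noncomputable def zetaEight : ℂ := Complex.exp ((Real.pi / 4 : ℝ) * Complex.I)

theorem zetaEight_pow_four : zetaEight ^ 4 = -1 := by
  rw [zetaEight, ← Complex.exp_nat_mul, ← Complex.exp_pi_mul_I]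
  congr 1
  push_cast
  ring

theorem zetaEight_ne_zero : zetaEight ≠ 0 := Complex.exp_ne_zero _

theorem isDiagonal_T (q : Fin k) :
    IsDiagonal [.one .T q] fun x => if x q = 1 then zetaEight else 1 := by
  intro x
  rw [circuitMatrix_one_mulVec]
  have hq : x q = 0 ∨ x q = 1 := by generalize x q = b; revert b; decide
  rcases hq with hq | hq
  · have : update x q 0 = x := by rw [← hq, update_eq_self]
    simp [GateName.gate, phaseGate, hq, this]
  · have : update x q 1 = x := by rw [← hq, update_eq_self]
    simp [GateName.gate, phaseGate, hq, this, zetaEight]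

theorem isDiagonal_Tinv (q : Fin k) :
    IsDiagonal [.one .Tinv q] fun x => if x q = 1 then zetaEight⁻¹ else 1 := by
  intro x
  rw [circuitMatrix_one_mulVec]
  have hz : (starRingEnd ℂ) zetaEight = zetaEight⁻¹ := by
    rw [zetaEight, ← Complex.exp_conj, ← Complex.exp_neg, map_mul, Complex.conj_ofReal,
      Complex.conj_I, mul_neg]
  have hq : x q = 0 ∨ x q = 1 := by generalize x q = b; revert b; decide
  rcases hq with hq | hq
  · have : update x q 0 = x := by rw [← hq, update_eq_self]
    simp [GateName.gate, phaseGate, hq, this, Matrix.star_apply]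
  · have : update x q 1 = x := by rw [← hq, update_eq_self]
    have hT : GateName.Tinv.gate.1 1 1 = zetaEight⁻¹ := by
      rw [← hz]
      rfl
    have hT' : GateName.Tinv.gate.1 0 1 = 0 := star_zero ℂ
    simp [hq, this, hT, hT']

theorem isDiagonal_Z (q : Fin k) :
    IsDiagonal [.one .Z q] fun x => if x q = 1 then -1 else 1 := by
  intro x
  rw [circuitMatrix_one_mulVec]
  have hq : x q = 0 ∨ x q = 1 := by generalize x q = b; revert b; decide
  rcases hq with hq | hq
  · have : update x q 0 = x := by rw [← hq, update_eq_self]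
    simp [GateName.gate, phaseGate, hq, this]
  · have : update x q 1 = x := by rw [← hq, update_eq_self]
    simp [GateName.gate, phaseGate, hq, this]

theorem isPermutation_X (q : Fin k) :
    IsPermutation [.one .X q] fun x => update x q (x q + 1) := by
  intro x
  rw [circuitMatrix_one_mulVec]
  have hq : x q = 0 ∨ x q = 1 := by generalize x q = b; revert b; decide
  rcases hq with hq | hq <;> simp [GateName.gate, notGate, hq]

theorem inv_sqrt_two_mul_self : ((√2 : ℝ) : ℂ)⁻¹ * ((√2 : ℝ) : ℂ)⁻¹ = 1 / 2 := by
  rw [← mul_inv, ← Complex.ofReal_mul, Real.mul_self_sqrt (by norm_num)]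
  norm_num

theorem circuitMatrix_H_mulVec_zero {q : Fin k} {x : Fin k → Fin 2} (hq : x q = 0) :
    circuitMatrix [.one .H q] *ᵥ ket x =
      ((√2 : ℝ) : ℂ)⁻¹ • (ket (update x q 0) + ket (update x q 1)) := by
  rw [circuitMatrix_one_mulVec]
  simp [GateName.gate, hadamardGate, hq]

theorem circuitMatrix_H_mulVec_one {q : Fin k} {x : Fin k → Fin 2} (hq : x q = 1) :
    circuitMatrix [.one .H q] *ᵥ ket x =
      ((√2 : ℝ) : ℂ)⁻¹ • (ket (update x q 0) - ket (update x q 1)) := by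
  rw [circuitMatrix_one_mulVec]
  simp [GateName.gate, hadamardGate, hq, neg_div, sub_eq_add_neg]

/-- Conjugation by a Hadamard gate turns a controlled phase into a controlled negation. -/
theorem IsDiagonal.conj_H {L : List (WireGate (Fin k))} {d : (Fin k → Fin 2) → ℂ} {t : Fin k}
    {f : (Fin k → Fin 2) → Fin 2} (h : IsDiagonal L d)
    (hd : ∀ x b, d (update x t b) = if f x = 1 ∧ b = 1 then -1 else 1) :
    IsPermutation ([.one .H t] ++ (L ++ [.one .H t])) fun x => update x t (x t + f x) := by
  intro x
  have h0 := circuitMatrix_H_mulVec_zero (q := t) (x := update x t 0) (by simp)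
  have h1 := circuitMatrix_H_mulVec_one (q := t) (x := update x t 1) (by simp)
  have hc := inv_sqrt_two_mul_self
  rw [circuitMatrix_append_mulVec, circuitMatrix_append_mulVec]
  have hq : x t = 0 ∨ x t = 1 := by generalize x t = b; revert b; decide
  have hf : f x = 0 ∨ f x = 1 := by generalize f x = b; revert b; decide
  rcases hq with hq | hq
  · rw [circuitMatrix_H_mulVec_zero hq]
    -- If `f x = 0` the middle acts trivially and the two Hadamard gates cancel; if `f x = 1` it
    -- acts as `Z` on `t`, and `HZH = X`.
    rcases hf with hf | hf <;>
      simp only [Matrix.mulVec_smul, Matrix.mulVec_add, h _, hd, h0, h1, hf, hq, update_idem] <;>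
      ext y <;> simp <;> first
        | linear_combination (2 * ket (update x t 0) y) * hc
        | linear_combination (2 * ket (update x t 1) y) * hc
  · rw [circuitMatrix_H_mulVec_one hq]
    rcases hf with hf | hf <;>
      simp only [Matrix.mulVec_smul, Matrix.mulVec_sub, h _, hd, h0, h1, hf, hq, update_idem] <;>
      ext y <;> simp <;> first
        | linear_combination (2 * ket (update x t 0) y) * hc
        | linear_combination (2 * ket (update x t 1) y) * hc

theorem isPermutation_cnot {c t : Fin k} (h : c ≠ t) :
    IsPermutation (cnot c t) fun x => update x t (x t + x c) := by
  refine IsDiagonal.conj_H (L := [.csign c t]) (circuitMatrix_csign_mulVec h) ?_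
  intro x b
  simp [update_of_ne h]

theorem fin_two_add_self (b : Fin 2) : b + b = 0 := by revert b; decide

theorem cnot_cnot {c t : Fin k} (h : c ≠ t) (x : Fin k → Fin 2) :
    update (update x t (x t + x c)) t
      (update x t (x t + x c) t + update x t (x t + x c) c) = x := by
  simp [update_of_ne h, add_assoc, fin_two_add_self]

/-- For bits, 4abc = a + b + c - (a⊕b) - (a⊕c) - (b⊕c) + (a⊕b⊕c). Raising `zetaEight` to both sides
expresses (-1)^(abc) by phases that depend on single parities, one `T` or `T⁻¹` for each term. -/
theorem isDiagonal_ccsign {a b c : Fin k} (hab : a ≠ b) (hac : a ≠ c) (hbc : b ≠ c) :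
    IsDiagonal (ccsign a b c) fun x => if x a = 1 ∧ x b = 1 ∧ x c = 1 then -1 else 1 := by
  have hAB := isPermutation_cnot hab
  have hAC := isPermutation_cnot hac
  have hBC := isPermutation_cnot hbc
  have key := (isDiagonal_T a).append ((isDiagonal_T b).append ((isDiagonal_T c).append
    (((isDiagonal_Tinv c).conj hBC hBC (cnot_cnot hbc)).append
    (((isDiagonal_Tinv c).conj hAC hAC (cnot_cnot hac)).append
    (((isDiagonal_Tinv b).conj hAB hAB (cnot_cnot hab)).append
    (((isDiagonal_T c).conj hBC hBC (cnot_cnot hbc)).conj hAC hAC (cnot_cnot hac)))))))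
  intro x
  refine (key x).trans ?_
  congr 1
  have hz := zetaEight_pow_four
  have h0 := zetaEight_ne_zero
  simp only [update_self, update_of_ne hbc]
  generalize x a = p
  generalize x b = q
  generalize x c = r
  fin_cases p <;> fin_cases q <;> fin_cases r <;> simp <;> field_simp
  -- Only the case where all three bits are 1 needs a relation: the odd parities contribute
  -- `zetaEight ^ 4`.
  linear_combination hz

theorem isPermutation_toffoli {a b t : Fin k} (hab : a ≠ b) (hat : a ≠ t) (hbt : b ≠ t) :
    IsPermutation (toffoli a b t) fun x => update x t (x t + x a * x b) := by
  refine IsDiagonal.conj_H (f := fun x => x a * x b) (isDiagonal_ccsign hab hat hbt) ?_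
  intro x c
  simp only [update_self, update_of_ne hat, update_of_ne hbt]
  generalize x a = p
  generalize x b = q
  revert p q c
  have : ∀ p q : Fin 2, p * q = 1 ↔ p = 1 ∧ q = 1 := by decide
  intro c p q
  simp [this, and_assoc]

/-- A classical gate may read the same wire twice, but a Toffoli gate needs distinct controls. Hence
one factor is first added to the scratch qubit, which serves as control and is restored afterwards.
-/
theorem isPermutation_addMul {s a b t : Fin k} (hsa : s ≠ a) (hsb : s ≠ b) (hst : s ≠ t)
    (hat : a ≠ t) (hbt : b ≠ t) :
    IsPermutation (addMul s a b t) fun x => update x t (x t + (x s + x a) * x b) := by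
  intro x
  refine (((isPermutation_cnot hsa.symm).append ((isPermutation_toffoli hsb hst hbt).append
    (isPermutation_cnot hsa.symm))) x).trans ?_
  congr 1
  ext j
  by_cases hj : j = t
  · subst hj
    simp [update_of_ne hst.symm, update_of_ne hsb.symm]
  · by_cases hjs : j = s
    · subst hjs
      simp [update_of_ne hst, update_of_ne hsa.symm, update_of_ne hat, add_assoc, fin_two_add_self]
    · simp [update_of_ne hj, update_of_ne hjs]

end Action

/-! ### The quantum circuit of a classical circuit -/

/-- The qubits on which the block of a gate acts. -/
inductive Port where
  | scratch
  | target
  | left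
  | right

/-- The block of gates that adds the value of a classical gate to the target qubit. -/
def BoolGate.block : BoolGate → List (WireGate Port)
  | .const false => []
  | .const true => [.one .X .target]
  | .not _ => [.one .X .target] ++ cnot .left .target
  | .and _ _ => addMul .scratch .left .right .target
  | .or _ _ => addMul .scratch .left .right .target ++
      (cnot .left .target ++ cnot .right .target)

/-- Wire `a` is stored in qubit `a + 1`; the scratch qubit is `0`. -/
def BoolGate.qubit (g : BoolGate) (t : ℕ) : Port → ℕ
  | .scratch => 0
  | .target => t
  | .left => g.inputs.getD 0 0 + 1
  | .right => g.inputs.getD 1 0 + 1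

/-- The block of a gate with target qubit `t`. -/
def BoolGate.blockAt (g : BoolGate) (t : ℕ) : List (WireGate ℕ) :=
  g.block.map (WireGate.map (g.qubit t))

/-- The blocks of successive gates, the first of which has target `t`. -/
def computeBlocks : ℕ → List BoolGate → List (WireGate ℕ)
  | _, [] => []
  | t, g :: gs => g.blockAt t ++ computeBlocks (t + 1) gs

/-- The blocks of successive gates in reverse order. -/
def uncomputeBlocks : ℕ → List BoolGate → List (WireGate ℕ)
  | _, [] => []
  | t, g :: gs => uncomputeBlocks (t + 1) gs ++ g.blockAt t

/-- Hadamard gates on the qubits `1, …, n`. -/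
def hadamards : ℕ → List (WireGate ℕ)
  | 0 => []
  | n + 1 => hadamards n ++ [.one .H (n + 1)]

/-- The gates of the compiled circuit. -/
def BoolCircuit.compiledGates {n : ℕ} (C : BoolCircuit n) : List (WireGate ℕ) :=
  hadamards n ++ (computeBlocks (n + 1) C.gates ++ ([.one .Z (C.output + 1)] ++
    (uncomputeBlocks (n + 1) C.gates ++ (hadamards n).reverse)))

/-- Reduce the names of qubits to `Fin (N + 1)`. -/
def WireGate.toFin (N : ℕ) : WireGate ℕ → WireGate (Fin (N + 1)) :=
  WireGate.map (Fin.ofNat (N + 1))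

/-- The compiled circuit. -/
def BoolCircuit.compile {n : ℕ} (C : BoolCircuit n) : QProgram where
  qubits := n + C.gates.length + 1
  gates := (C.compiledGates.map (WireGate.toFin (n + C.gates.length))).flatMap WireGate.toQGates

/-! ### The amplitude of the compiled circuit. -/

section Compiled

open Matrix Function

/-- A bit as an element of `Fin 2`. -/
def Bool.toFinTwo (b : Bool) : Fin 2 := if b then 1 else 0

/-- The basis state that stores the values of the wires computed so far. -/
def wireState (N : ℕ) (v : List Bool) : Fin (N + 1) → Fin 2 :=
  fun j => ((false :: v).getD j false).toFinTwo

variable {N : ℕ}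

theorem ofNat_val {a : ℕ} (h : a ≤ N) : (Fin.ofNat (N + 1) a : ℕ) = a :=
  Nat.mod_eq_of_lt (Nat.lt_succ_of_le h)

theorem ofNat_ne {a b : ℕ} (ha : a ≤ N) (hb : b ≤ N) (h : a ≠ b) :
    Fin.ofNat (N + 1) a ≠ Fin.ofNat (N + 1) b := by
  intro e
  have := congrArg Fin.val e
  rw [ofNat_val ha, ofNat_val hb] at this
  exact h this

theorem wireState_zero (v : List Bool) : wireState N v (Fin.ofNat (N + 1) 0) = 0 := rfl

theorem wireState_succ (v : List Bool) {a : ℕ} (h : a + 1 ≤ N) :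
    wireState N v (Fin.ofNat (N + 1) (a + 1)) = (v.getD a false).toFinTwo := by
  rw [wireState, ofNat_val h, List.getD_cons_succ]

/-- Qubits beyond the stored wires read the default `false`, so a new wire changes one qubit only.
-/
theorem wireState_concat (v : List Bool) (b : Bool) (h : v.length + 1 ≤ N) :
    wireState N (v ++ [b]) =
      update (wireState N v) (Fin.ofNat (N + 1) (v.length + 1)) b.toFinTwo := by
  ext j
  by_cases hj : j = Fin.ofNat (N + 1) (v.length + 1)
  · subst hj
    rw [wireState_succ _ h, update_self]
    simp
  · have hj' : (j : ℕ) ≠ v.length + 1 := by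
      intro e
      exact hj (Fin.ext (by rw [ofNat_val h, e]))
    rw [update_of_ne hj, wireState, wireState]
    obtain ⟨j, hlt⟩ := j
    cases j with
    | zero => rfl
    | succ j =>
      simp only [List.getD_cons_succ]
      rcases lt_or_gt_of_ne (show j ≠ v.length by simpa using hj') with hlt | hgt
      · rw [List.getD_append _ _ _ _ hlt]
      · rw [List.getD_eq_default v _ hgt.le, List.getD_eq_default _ _ (by simp; omega)]

theorem wireState_target (v : List Bool) (h : v.length + 1 ≤ N) :
    wireState N v (Fin.ofNat (N + 1) (v.length + 1)) = 0 := by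
  rw [wireState_succ _ h, List.getD_eq_default _ _ le_rfl]
  rfl

theorem wireState_nil : wireState N [] = fun _ => 0 := by
  ext j
  obtain ⟨j, hlt⟩ := j
  cases j <;> simp [wireState, Bool.toFinTwo]

/-- The value added to the target by the block of a gate. -/
def BoolGate.increment (s a b : Fin 2) : BoolGate → Fin 2
  | .const c => c.toFinTwo
  | .not _ => 1 + a
  | .and _ _ => (s + a) * b
  | .or _ _ => (s + a) * b + (a + b)

/-- Negation is 1 + a and disjunction is ab + a + b modulo 2. The conditions on the left and right
ports depend on the arity because a missing input defaults to qubit 1, which can be the target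
itself. -/
theorem isPermutation_block {k : ℕ} (g : BoolGate) (p : Port → Fin k)
    (hst : p .scratch ≠ p .target)
    (hl : 1 ≤ g.inputs.length → p .scratch ≠ p .left ∧ p .left ≠ p .target)
    (hr : 2 ≤ g.inputs.length → p .scratch ≠ p .right ∧ p .right ≠ p .target) :
    IsPermutation (g.block.map (WireGate.map p)) fun x => update x (p .target)
      (x (p .target) + g.increment (x (p .scratch)) (x (p .left)) (x (p .right))) := by
  cases g with
  | const b =>
    cases b with
    | false =>
      intro x
      simp [BoolGate.block, circuitMatrix_nil, BoolGate.increment, Bool.toFinTwo]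
    | true => exact isPermutation_X _
  | not a =>
    obtain ⟨-, hlt⟩ := hl (by simp [BoolGate.inputs])
    intro x
    refine (((isPermutation_X (p .target)).append (isPermutation_cnot hlt)) x).trans ?_
    simp [BoolGate.increment, update_of_ne hlt, add_assoc]
  | and a b =>
    obtain ⟨hsl, hlt⟩ := hl (by simp [BoolGate.inputs])
    obtain ⟨hsr, hrt⟩ := hr (by simp [BoolGate.inputs])
    exact isPermutation_addMul hsl hsr hst hlt hrt
  | or a b =>
    obtain ⟨hsl, hlt⟩ := hl (by simp [BoolGate.inputs])
    obtain ⟨hsr, hrt⟩ := hr (by simp [BoolGate.inputs])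
    intro x
    refine (((isPermutation_addMul hsl hsr hst hlt hrt).append
      ((isPermutation_cnot hlt).append (isPermutation_cnot hrt))) x).trans ?_
    simp [BoolGate.increment, update_of_ne hlt, update_of_ne hrt, add_assoc]

theorem blockAt_toFin (g : BoolGate) (t : ℕ) :
    (g.blockAt t).map (toFin N) =
      g.block.map (WireGate.map fun p => Fin.ofNat (N + 1) (g.qubit t p)) := by
  rw [BoolGate.blockAt, List.map_map]
  congr 1
  funext u
  cases u <;> rfl

theorem isPermutation_blockAt (g : BoolGate) {t : ℕ} (ht : t + 1 ≤ N)
    (hg : ∀ a ∈ g.inputs, a < t) :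
    IsPermutation ((g.blockAt (t + 1)).map (toFin N)) fun x =>
      update x (Fin.ofNat (N + 1) (t + 1)) (x (Fin.ofNat (N + 1) (t + 1)) +
        g.increment (x (Fin.ofNat (N + 1) 0)) (x (Fin.ofNat (N + 1) (g.qubit (t + 1) .left)))
          (x (Fin.ofNat (N + 1) (g.qubit (t + 1) .right)))) := by
  rw [blockAt_toFin]
  have aux : ∀ i < g.inputs.length, g.inputs.getD i 0 < t := by
    intro i hi
    rw [List.getD_eq_getElem _ _ hi]
    exact hg _ (List.getElem_mem hi)
  refine isPermutation_block g (fun p => Fin.ofNat (N + 1) (g.qubit (t + 1) p))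
    (ofNat_ne (Nat.zero_le _) ht (by simp [BoolGate.qubit])) (fun h => ?_) (fun h => ?_)
  · have := aux 0 h
    exact ⟨ofNat_ne (Nat.zero_le _) (by simp only [BoolGate.qubit]; omega)
      (by simp [BoolGate.qubit]), ofNat_ne (by simp only [BoolGate.qubit]; omega) ht
      (by simp only [BoolGate.qubit]; omega)⟩
  · have := aux 1 h
    exact ⟨ofNat_ne (Nat.zero_le _) (by simp only [BoolGate.qubit]; omega)
      (by simp [BoolGate.qubit]), ofNat_ne (by simp only [BoolGate.qubit]; omega) ht
      (by simp only [BoolGate.qubit]; omega)⟩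

/-- Two lists are needed for uncomputation, where the state `w` already holds the value of the gate
while the gate is evaluated on the earlier wires `v`. -/
theorem increment_wireState (g : BoolGate) (v w : List Bool) {t : ℕ} (h : v.length + 1 ≤ N)
    (hg : ∀ a ∈ g.inputs, a < v.length) (hw : ∀ a < v.length, w.getD a false = v.getD a false) :
    g.increment (wireState N w (Fin.ofNat (N + 1) 0))
      (wireState N w (Fin.ofNat (N + 1) (g.qubit t .left)))
      (wireState N w (Fin.ofNat (N + 1) (g.qubit t .right))) = (g.eval v).toFinTwo := by
  cases g with
  | const b => rfl
  | not a =>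
    simp only [BoolGate.inputs, List.mem_singleton, forall_eq] at hg
    simp only [BoolGate.increment, BoolGate.qubit, BoolGate.inputs, List.getD_cons_zero,
      BoolGate.eval]
    rw [wireState_succ w (by omega), hw _ hg]
    generalize v.getD a false = p
    revert p; decide
  | and a b =>
    simp only [BoolGate.inputs, List.mem_cons, List.not_mem_nil, or_false, forall_eq_or_imp,
      forall_eq] at hg
    simp only [BoolGate.increment, BoolGate.qubit, BoolGate.inputs, List.getD_cons_zero,
      List.getD_cons_succ, BoolGate.eval]
    rw [wireState_succ w (by omega), wireState_succ w (by omega), hw _ hg.1, hw _ hg.2,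
      wireState_zero]
    generalize v.getD a false = p
    generalize v.getD b false = q
    revert p q; decide
  | or a b =>
    simp only [BoolGate.inputs, List.mem_cons, List.not_mem_nil, or_false, forall_eq_or_imp,
      forall_eq] at hg
    simp only [BoolGate.increment, BoolGate.qubit, BoolGate.inputs, List.getD_cons_zero,
      List.getD_cons_succ, BoolGate.eval]
    rw [wireState_succ w (by omega), wireState_succ w (by omega), hw _ hg.1, hw _ hg.2,
      wireState_zero]
    generalize v.getD a false = p
    generalize v.getD b false = q
    revert p q; decide

theorem blockAt_compute (g : BoolGate) (v : List Bool) (h : v.length + 1 ≤ N)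
    (hg : ∀ a ∈ g.inputs, a < v.length) :
    circuitMatrix ((g.blockAt (v.length + 1)).map (toFin N)) *ᵥ ket (wireState N v) =
      ket (wireState N (v ++ [g.eval v])) := by
  rw [isPermutation_blockAt g h hg]
  beta_reduce
  rw [increment_wireState g v v h hg fun _ _ => rfl,
    wireState_target v h, zero_add, wireState_concat v _ h]

/-- The block reads only earlier wires, so it adds the same bit a second time, and twice a bit is
zero modulo 2. -/
theorem blockAt_uncompute (g : BoolGate) (v : List Bool) (h : v.length + 1 ≤ N)
    (hg : ∀ a ∈ g.inputs, a < v.length) :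
    circuitMatrix ((g.blockAt (v.length + 1)).map (toFin N)) *ᵥ
      ket (wireState N (v ++ [g.eval v])) = ket (wireState N v) := by
  rw [isPermutation_blockAt g h hg]
  beta_reduce
  rw [increment_wireState g v _ h hg
    fun a ha => List.getD_append _ _ _ _ ha]
  rw [wireState_concat v _ h, update_self, fin_two_add_self, update_idem]
  congr 1
  rw [← wireState_target v h, update_eq_self]

/-- The gates read only wires that precede them, the first gate being wire `t`. -/
def InputsPrecede (t : ℕ) (gs : List BoolGate) : Prop :=
  ∀ (i : ℕ) (h : i < gs.length), ∀ a ∈ gs[i].inputs, a < t + i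

theorem InputsPrecede.head {t : ℕ} {g : BoolGate} {gs : List BoolGate}
    (h : InputsPrecede t (g :: gs)) : ∀ a ∈ g.inputs, a < t :=
  h 0 (by simp)

theorem InputsPrecede.tail {t : ℕ} {g : BoolGate} {gs : List BoolGate}
    (h : InputsPrecede t (g :: gs)) : InputsPrecede (t + 1) gs := by
  intro i hi a ha
  have := h (i + 1) (by simpa using hi) a (by simpa using ha)
  omega

theorem computeBlocks_mulVec (gs : List BoolGate) (v : List Bool)
    (h : v.length + gs.length ≤ N) (hgs : InputsPrecede v.length gs) :
    circuitMatrix ((computeBlocks (v.length + 1) gs).map (toFin N)) *ᵥ ket (wireState N v) =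
      ket (wireState N (gs.foldl (fun v g => v ++ [g.eval v]) v)) := by
  induction gs generalizing v with
  | nil => simp [computeBlocks, circuitMatrix_nil]
  | cons g gs ih =>
    rw [List.length_cons] at h
    rw [computeBlocks, List.map_append, circuitMatrix_append_mulVec,
      blockAt_compute g v (by omega) hgs.head]
    have := ih (v ++ [g.eval v]) (by simp; omega) (by simpa using hgs.tail)
    simpa using this

theorem uncomputeBlocks_mulVec (gs : List BoolGate) (v : List Bool)
    (h : v.length + gs.length ≤ N) (hgs : InputsPrecede v.length gs) :
    circuitMatrix ((uncomputeBlocks (v.length + 1) gs).map (toFin N)) *ᵥ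
      ket (wireState N (gs.foldl (fun v g => v ++ [g.eval v]) v)) = ket (wireState N v) := by
  induction gs generalizing v with
  | nil => simp [uncomputeBlocks, circuitMatrix_nil]
  | cons g gs ih =>
    rw [List.length_cons] at h
    rw [uncomputeBlocks, List.map_append, circuitMatrix_append_mulVec]
    have := ih (v ++ [g.eval v]) (by simp; omega) (by simpa using hgs.tail)
    rw [List.length_append, List.length_singleton] at this
    rw [List.foldl_cons, this, blockAt_uncompute g v (by omega) hgs.head]

/-- Computing the wires, applying `Z` to the output and uncomputing multiplies the state that stores
the input by the sign of the output. -/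
theorem query_mulVec {n : ℕ} (C : BoolCircuit n) (x : Fin n → Bool) :
    circuitMatrix ((computeBlocks (n + 1) C.gates ++ ([WireGate.one .Z (C.output + 1)] ++
      uncomputeBlocks (n + 1) C.gates)).map (toFin (n + C.gates.length))) *ᵥ
        ket (wireState _ (List.ofFn x)) = (C.sign x : ℂ) • ket (wireState _ (List.ofFn x)) := by
  have hlen : (List.ofFn x).length = n := List.length_ofFn
  have h1 := computeBlocks_mulVec (N := n + C.gates.length) C.gates (List.ofFn x)
    (by rw [hlen]) (by rw [hlen]; exact C.gates_wf)
  have h2 := uncomputeBlocks_mulVec (N := n + C.gates.length) C.gates (List.ofFn x)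
    (by rw [hlen]) (by rw [hlen]; exact C.gates_wf)
  rw [hlen] at h1 h2
  rw [List.map_append, List.map_append, circuitMatrix_append_mulVec, h1,
    circuitMatrix_append_mulVec]
  have hZ := isDiagonal_Z (Fin.ofNat (n + C.gates.length + 1) (C.output + 1))
    (wireState _ (C.wires x))
  beta_reduce at hZ
  rw [wireState_succ _ (Nat.succ_le_of_lt C.output_wf)] at hZ
  change _ *ᵥ (circuitMatrix [.one .Z (Fin.ofNat (n + C.gates.length + 1) (C.output + 1))] *ᵥ
    ket (wireState _ (C.wires x))) = _
  rw [hZ, Matrix.mulVec_smul, BoolCircuit.wires, h2, BoolCircuit.sign, BoolCircuit.bit,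
    BoolCircuit.wires]
  congr 1
  generalize List.getD _ _ _ = b
  cases b <;> simp [Bool.toFinTwo]

/-- Induction on the number of inputs: the next qubit is still 0, and its Hadamard gate splits every
basis state into the two extensions of its string. -/
theorem hadamards_mulVec (n : ℕ) (h : n ≤ N) :
    circuitMatrix ((hadamards n).map (toFin N)) *ᵥ ket (wireState N []) =
      (((√2 : ℝ) : ℂ)⁻¹ ^ n) • ∑ x : Fin n → Bool, ket (wireState N (List.ofFn x)) := by
  induction n with
  | zero => simp [hadamards, circuitMatrix_nil]
  | succ n ih =>
    rw [hadamards, List.map_append, circuitMatrix_append_mulVec, ih (by omega),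
      Matrix.mulVec_smul, Matrix.mulVec_sum, pow_succ, mul_smul]
    congr 1
    -- The last bit is split off, since the new qubit comes after the stored ones.
    rw [← (Fin.snocEquiv fun _ => Bool).sum_comp, Fintype.sum_prod_type, Fintype.sum_bool,
      ← Finset.sum_add_distrib, Finset.smul_sum]
    refine Finset.sum_congr rfl fun x _ => ?_
    have hlen : (List.ofFn x).length = n := List.length_ofFn
    have key := circuitMatrix_H_mulVec_zero (wireState_target (N := N) (List.ofFn x) (by omega))
    have e : ∀ b, List.ofFn (Fin.snoc (α := fun _ => Bool) x b) = List.ofFn x ++ [b] := by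
      intro b
      rw [List.ofFn_succ']
      simp [List.concat_eq_append]
    have e0 := wireState_concat (N := N) (List.ofFn x) false (by omega)
    have e1 := wireState_concat (N := N) (List.ofFn x) true (by omega)
    simp only [hlen] at key e0 e1
    refine key.trans ?_
    simp only [Fin.snocEquiv, Equiv.coe_fn_mk, e, e0, e1]
    exact congrArg _ (add_comm _ _)

theorem circuitMatrix_H_transpose {k : ℕ} (q : Fin k) :
    (circuitMatrix [.one .H q])ᵀ = circuitMatrix [.one .H q] := by
  have hs : ∀ i j : Fin 2, GateName.H.gate.1 i j = GateName.H.gate.1 j i := by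
    intro i j
    fin_cases i <;> fin_cases j <;> simp [GateName.gate, hadamardGate]
  rw [circuitMatrix_one]
  ext x y
  simp only [QGate.matrix, Matrix.transpose_apply, Matrix.of_apply, hs (x q) (y q)]
  simp only [eq_comm]

/-- `H` is symmetric, so the closing layer is the transpose of the opening one and the amplitude
becomes the bilinear form φᵀMφ, without complex conjugation. -/
theorem hadamards_reverse_transpose (n : ℕ) :
    (circuitMatrix ((hadamards n).map (toFin N)))ᵀ =
      circuitMatrix ((hadamards n).reverse.map (toFin N)) := by
  induction n with
  | zero => simp [hadamards, circuitMatrix_nil]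
  | succ n ih =>
    rw [hadamards, List.map_append, circuitMatrix_append, List.reverse_append, List.map_append,
      circuitMatrix_append, Matrix.transpose_mul, ih]
    congr 1
    exact circuitMatrix_H_transpose _

theorem wireState_ofFn_injective {n : ℕ} (h : n ≤ N) :
    Injective fun x : Fin n → Bool => wireState N (List.ofFn x) := by
  intro x y e
  ext i
  have := congrFun e (Fin.ofNat (N + 1) (i + 1))
  simp only at this
  rw [wireState_succ _ (by omega), wireState_succ _ (by omega)] at this
  have inj : Injective Bool.toFinTwo := by decide
  simpa using inj this

theorem compile_amplitude {n : ℕ} (C : BoolCircuit n) :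
    C.compile.circuit.amplitude = (C.delta : ℂ) / 2 ^ n := by
  set N := n + C.gates.length with hN
  change circuitMatrix (C.compiledGates.map (toFin N)) (fun _ => 0) (fun _ => 0) = _
  set M := circuitMatrix ((computeBlocks (n + 1) C.gates ++ ([WireGate.one .Z (C.output + 1)] ++
      uncomputeBlocks (n + 1) C.gates)).map (toFin N)) with hM
  set U := circuitMatrix ((hadamards n).map (toFin N)) with hU
  have hsplit : circuitMatrix (C.compiledGates.map (toFin N)) = Uᵀ * (M * U) := by
    rw [hU, hadamards_reverse_transpose, hM, ← circuitMatrix_append, ← circuitMatrix_append]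
    simp [BoolCircuit.compiledGates]
  set φ := U *ᵥ ket (wireState N []) with hφ
  have h0 : ∀ A : Matrix (Fin (N + 1) → Fin 2) (Fin (N + 1) → Fin 2) ℂ,
      A (fun _ => 0) (fun _ => 0) = ket (wireState N []) ⬝ᵥ (A *ᵥ ket (wireState N [])) := by
    intro A
    simp [ket, wireState_nil]
  have h1 := h0 (Uᵀ * (M * U))
  rw [hsplit]
  refine h1.trans ?_
  rw [← Matrix.mulVec_mulVec, Matrix.dotProduct_mulVec, Matrix.vecMul_transpose,
    ← Matrix.mulVec_mulVec, ← hφ, hφ, hadamards_mulVec n (by omega)]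
  rw [Matrix.mulVec_smul, Matrix.mulVec_sum, smul_dotProduct, dotProduct_smul, smul_smul]
  rw [Finset.sum_congr rfl fun x _ => query_mulVec C x, sum_dotProduct]
  -- Distinct inputs are stored in distinct, hence orthogonal, basis states, so only the diagonal
  -- term survives.
  have hsum : ∀ x : Fin n → Bool, ket (wireState N (List.ofFn x)) ⬝ᵥ
      ∑ y, (C.sign y : ℂ) • ket (wireState N (List.ofFn y)) = C.sign x := by
    intro x
    rw [dotProduct_sum, Finset.sum_eq_single x]
    · simp [ket]
    · intro y _ hy
      have : wireState N (List.ofFn x) ≠ wireState N (List.ofFn y) :=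
        fun e => hy (wireState_ofFn_injective (by omega) e).symm
      simp [ket, this]
    · simp
  rw [Finset.sum_congr rfl fun x _ => hsum x, ← mul_pow, inv_sqrt_two_mul_self, BoolCircuit.delta,
    smul_eq_mul]
  push_cast
  rw [one_div, inv_pow, div_eq_inv_mul]

end Compiled

/-! ### A small imperative language for stack machines -/

/-- Counters of the machine. -/
inductive Counter where
  | target
  | left
  | right
  | total
  | temp
  deriving DecidableEq

instance : Fintype Counter :=
  ⟨{.target, .left, .right, .total, .temp}, by intro c; cases c <;> decide⟩

/-- The memory of the machine: a register, two stacks of circuit symbols, the counters, and the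
output stack. -/
structure Store where
  reg : Option CircuitSymbol
  src : Bool → List CircuitSymbol
  cnt : Counter → ℕ
  out : List ProgramSymbol

/-- Programs. Instructions that do not load the register clear it. -/
inductive Prog where
  | clear
  | inc (c : Counter)
  | dec (c : Counter)
  | read (b : Bool)
  | write (b : Bool) (a : CircuitSymbol)
  | emit (a : ProgramSymbol)
  | seq (p q : Prog)
  | ite (c : Option CircuitSymbol → Bool) (p q : Prog)
  | loop (c : Option CircuitSymbol → Bool) (p : Prog)

open Function

/-- `Runs p s s' t`: the program `p` takes `s` to `s'` in at most `t` steps. -/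
inductive Runs : Prog → Store → Store → ℕ → Prop
  | clear (s : Store) : Runs .clear s ⟨none, s.src, s.cnt, s.out⟩ 1
  | inc (c : Counter) (s : Store) :
      Runs (.inc c) s ⟨none, s.src, update s.cnt c (s.cnt c + 1), s.out⟩ 1
  | dec (c : Counter) (s : Store) :
      Runs (.dec c) s ⟨if s.cnt c = 0 then none else some .tick, s.src,
        update s.cnt c (s.cnt c - 1), s.out⟩ 1
  | read (b : Bool) (s : Store) :
      Runs (.read b) s ⟨(s.src b).head?, update s.src b (s.src b).tail, s.cnt, s.out⟩ 1
  | write (b : Bool) (a : CircuitSymbol) (s : Store) :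
      Runs (.write b a) s ⟨none, update s.src b (a :: s.src b), s.cnt, s.out⟩ 1
  | emit (a : ProgramSymbol) (s : Store) : Runs (.emit a) s ⟨none, s.src, s.cnt, a :: s.out⟩ 1
  | seq {p q : Prog} {s s' s'' : Store} {t t' : ℕ} :
      Runs p s s' t → Runs q s' s'' t' → Runs (.seq p q) s s'' (t + t')
  | ite_true {c : Option CircuitSymbol → Bool} {p q : Prog} {s s' : Store} {t : ℕ} :
      c s.reg = true → Runs p s s' t → Runs (.ite c p q) s s' (t + 1)
  | ite_false {c : Option CircuitSymbol → Bool} {p q : Prog} {s s' : Store} {t : ℕ} :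
      c s.reg = false → Runs q s s' t → Runs (.ite c p q) s s' (t + 1)
  | loop_false {c : Option CircuitSymbol → Bool} {p : Prog} {s : Store} :
      c s.reg = false → Runs (.loop c p) s s 1
  | loop_true {c : Option CircuitSymbol → Bool} {p : Prog} {s s' s'' : Store} {t t' : ℕ} :
      c s.reg = true → Runs p s s' t → Runs (.loop c p) s' s'' t' →
        Runs (.loop c p) s s'' (t + t' + 1)
  | weaken {p : Prog} {s s' : Store} {t t' : ℕ} : Runs p s s' t → t ≤ t' → Runs p s s' t'

theorem Runs.cast {p : Prog} {s s' s'' : Store} {t t' : ℕ} (h : Runs p s s' t) (e : s' = s'')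
    (ht : t ≤ t') : Runs p s s'' t' :=
  e ▸ h.weaken ht

/-! ### Compilation to a stack machine -/

/-- The stacks of the machine. -/
inductive Tape where
  | src (b : Bool)
  | cnt (c : Counter)
  | out
  deriving DecidableEq, Fintype

/-- The alphabets of the stacks. -/
def Tape.Alphabet : Tape → Type
  | .src _ => CircuitSymbol
  | .cnt _ => Unit
  | .out => ProgramSymbol

/-- The contents of the stacks. -/
def Store.stacks (s : Store) : ∀ k : Tape, List k.Alphabet
  | .src b => s.src b
  | .cnt c => List.replicate (s.cnt c) ()
  | .out => s.out

namespace Prog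

/-- Statements of the machine. -/
abbrev Statement (Λ : Type) : Type := Turing.TM2.Stmt Tape.Alphabet Λ (Option CircuitSymbol)

/-- The control points of a program. -/
def Label : Prog → Type
  | .seq p q => p.Label ⊕ q.Label
  | .ite _ p q => Option (p.Label ⊕ q.Label)
  | .loop _ p => Option p.Label
  | _ => Unit

/-- There are finitely many control points. -/
@[reducible] def labelFintype : ∀ p : Prog, Fintype p.Label
  | .seq p q => @instFintypeSum _ _ p.labelFintype q.labelFintype
  | .ite _ p q =>
      @instFintypeOption _ (@instFintypeSum _ _ p.labelFintype q.labelFintype)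
  | .loop _ p => @instFintypeOption _ p.labelFintype
  | .clear | .inc _ | .dec _ | .read _ | .write _ _ | .emit _ => inferInstanceAs (Fintype Unit)

/-- The first control point. -/
def entry : ∀ p : Prog, p.Label
  | .seq p _ => Sum.inl p.entry
  | .ite _ _ _ => none
  | .loop _ _ => none
  | .clear | .inc _ | .dec _ | .read _ | .write _ _ | .emit _ => ()

/-- The statements of a program whose control points are embedded by `e` and which continues with
`k`. -/
def code {Λ : Type} : ∀ p : Prog, (p.Label → Λ) → Statement Λ → p.Label → Statement Λ
  | .clear, _, k, _ => .load (fun _ => none) k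
  | .inc c, _, k, _ => .push (.cnt c) (fun _ => ()) (.load (fun _ => none) k)
  | .dec c, _, k, _ => .pop (.cnt c) (fun _ o => Option.map (fun _ => .tick) o) k
  | .read b, _, k, _ => .pop (.src b) (fun _ o => o) k
  | .write b a, _, k, _ => .push (.src b) (fun _ => a) (.load (fun _ => none) k)
  | .emit a, _, k, _ => .push .out (fun _ => a) (.load (fun _ => none) k)
  | .seq p q, e, _, .inl l =>
      p.code (fun l => e (.inl l)) (.goto fun _ => e (.inr q.entry)) l
  | .seq _ q, e, k, .inr l => q.code (fun l => e (.inr l)) k l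
  | .ite c p q, e, _, none => .branch c (.goto fun _ => e (some (.inl p.entry)))
      (.goto fun _ => e (some (.inr q.entry)))
  | .ite _ p _, e, k, some (.inl l) => p.code (fun l => e (some (.inl l))) k l
  | .ite _ _ q, e, k, some (.inr l) => q.code (fun l => e (some (.inr l))) k l
  | .loop c p, e, k, none => .branch c (.goto fun _ => e (some p.entry)) k
  | .loop _ p, e, _, some l => p.code (fun l => e (some l)) (.goto fun _ => e none) l

/-- The machine that runs a program. -/
def machine (p : Prog) : Turing.FinTM2 where
  K := Tape
  k₀ := .src false
  k₁ := .out
  Γ := Tape.Alphabet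
  Λ := p.Label
  main := p.entry
  ΛFin := p.labelFintype
  σ := Option CircuitSymbol
  initialState := none
  Γk₀Fin := inferInstanceAs (Fintype CircuitSymbol)
  m := p.code id .halt

end Prog

/-! ### Simulation of programs by the stack machine. -/

theorem Store.stacks_src (s : Store) (b : Bool) (l : List CircuitSymbol) (v : Option CircuitSymbol) :
    update s.stacks (.src b) l = Store.stacks ⟨v, update s.src b l, s.cnt, s.out⟩ := by
  funext k
  rcases k with b' | c | _
  · by_cases h : b' = b
    · subst h
      exact (update_self (f := s.stacks) (.src b') l).trans
        (update_self (f := s.src) b' l).symm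
    · exact (update_of_ne (β := fun k : Tape => List k.Alphabet)
        (show Tape.src b' ≠ .src b by simpa using h) l s.stacks).trans
        (show s.src b' = update s.src b l b' from (update_of_ne h l s.src).symm)
  · rfl
  · rfl

theorem Store.stacks_cnt (s : Store) (c : Counter) (x : ℕ) (v : Option CircuitSymbol) :
    update s.stacks (.cnt c) (List.replicate x ()) =
      Store.stacks ⟨v, s.src, update s.cnt c x, s.out⟩ := by
  funext k
  rcases k with b' | c' | _
  · rfl
  · by_cases h : c' = c
    · subst h; simp [Store.stacks]
    · simp [Store.stacks, h]
  · rfl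

theorem Store.stacks_out (s : Store) (l : List ProgramSymbol) (v : Option CircuitSymbol) :
    update s.stacks .out l = Store.stacks ⟨v, s.src, s.cnt, l⟩ := by
  funext k
  rcases k with b' | c' | _ <;> rfl

/-- The result is stated through `stepAux k` because the continuation is executed within the last
step of the program. This makes sequencing free of charge and lets the induction vary `k`: a jump to
the second half, back to the loop head, or a halt. -/
theorem Runs.exec {p : Prog} {s s' : Store} {t : ℕ} (h : Runs p s s' t) {Λ : Type}
    (M : Λ → Prog.Statement Λ) (e : p.Label → Λ) (k : Prog.Statement Λ)
    (hM : ∀ l, M (e l) = p.code e k l) :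
    ∃ t' ≤ t, (flip bind (Turing.TM2.step M))^[t']
      (some ⟨some (e p.entry), s.reg, s.stacks⟩) =
        some (Turing.TM2.stepAux k s'.reg s'.stacks) := by
  have single : ∀ {p : Prog} (e : p.Label → Λ) (k : Prog.Statement Λ)
      (s s' : Store), (∀ l, M (e l) = p.code e k l) →
      Turing.TM2.stepAux (p.code e k p.entry) s.reg s.stacks =
        Turing.TM2.stepAux k s'.reg s'.stacks →
      ∃ t' ≤ 1, (flip bind (Turing.TM2.step M))^[t']
        (some ⟨some (e p.entry), s.reg, s.stacks⟩) =
          some (Turing.TM2.stepAux k s'.reg s'.stacks) := by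
    intro p e k s s' hM h
    refine ⟨1, le_rfl, ?_⟩
    rw [← h, ← hM]
    rfl
  induction h generalizing k with
  | clear s => exact single e k s _ hM rfl
  | inc c s =>
    refine single e k s _ hM ?_
    simp only [Prog.code, Turing.TM2.stepAux]
    rw [← s.stacks_cnt c _ none]
    rfl
  | dec c s =>
    refine single e k s _ hM ?_
    simp only [Prog.code, Turing.TM2.stepAux]
    rw [← s.stacks_cnt c _ _]
    simp only [Store.stacks]
    -- Popping an empty stack yields `none` and leaves it empty, in agreement with truncated
    -- subtraction.
    cases s.cnt c <;> rfl
  | read b s =>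
    refine single e k s _ hM ?_
    simp only [Prog.code, Turing.TM2.stepAux]
    rw [← s.stacks_src b _ _]
    rfl
  | write b a s =>
    refine single e k s _ hM ?_
    simp only [Prog.code, Turing.TM2.stepAux]
    rw [← s.stacks_src b _ none]
    rfl
  | emit a s =>
    refine single e k s _ hM ?_
    simp only [Prog.code, Turing.TM2.stepAux]
    rw [← s.stacks_out _ none]
    rfl
  | @seq p q s s' s'' t t' _ _ ih ih' =>
    obtain ⟨a, ha, h⟩ := ih (fun l => e (.inl l)) (.goto fun _ => e (.inr q.entry))
      fun l => hM (.inl l)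
    obtain ⟨a', ha', h'⟩ := ih' (fun l => e (.inr l)) k fun l => hM (.inr l)
    refine ⟨a' + a, by omega, ?_⟩
    rw [iterate_add_apply]
    exact (congrArg _ h).trans h'
  | @ite_true c p q s s' t hc _ ih =>
    obtain ⟨a, ha, h⟩ := ih (fun l => e (some (.inl l))) k fun l => hM (some (.inl l))
    -- The extra step is the branch at the control point `none`.
    refine ⟨a + 1, by omega, ?_⟩
    rw [iterate_succ_apply]
    refine (congrArg _ ?_).trans h
    change some (Turing.TM2.stepAux (M (e none)) _ _) = _
    rw [hM none]
    simp [Prog.code, hc]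
  | @ite_false c p q s s' t hc _ ih =>
    obtain ⟨a, ha, h⟩ := ih (fun l => e (some (.inr l))) k fun l => hM (some (.inr l))
    refine ⟨a + 1, by omega, ?_⟩
    rw [iterate_succ_apply]
    refine (congrArg _ ?_).trans h
    change some (Turing.TM2.stepAux (M (e none)) _ _) = _
    rw [hM none]
    simp [Prog.code, hc]
  | @loop_false c p s hc =>
    -- A failed test passes directly into the continuation, so leaving the loop costs one step.
    refine single e k s _ hM ?_
    simp [Prog.code, Prog.entry, hc]
  | @loop_true c p s s' s'' t t' hc _ _ ih ih' =>
    obtain ⟨a, ha, h⟩ := ih (fun l => e (some l)) (.goto fun _ => e none) fun l => hM (some l)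
    obtain ⟨a', ha', h'⟩ := ih' e k hM
    refine ⟨a' + (a + 1), by omega, ?_⟩
    rw [iterate_add_apply, iterate_succ_apply]
    refine (congrArg _ ?_).trans h'
    refine (congrArg _ ?_).trans h
    change some (Turing.TM2.stepAux (M (e none)) _ _) = _
    rw [hM none]
    simp [Prog.code, hc]
  | weaken _ ht ih =>
    obtain ⟨a, ha, h⟩ := ih e k hM
    exact ⟨a, ha.trans ht, h⟩

/-- The machine of a program, with its input and output alphabets. -/
def Prog.computer (p : Prog) : Turing.TM2ComputableAux CircuitSymbol ProgramSymbol where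
  tm := p.machine
  inputAlphabet := Equiv.refl CircuitSymbol
  outputAlphabet := Equiv.refl ProgramSymbol

/-- A halting configuration must have the initial register and no stack contents besides the output,
which is why the final store here is clean and why the compiler has to tidy up. -/
theorem Runs.outputsInTime {p : Prog} {x : List CircuitSymbol} {y : List ProgramSymbol} {t : ℕ}
    (h : Runs p ⟨none, fun b => if b = false then x else [], fun _ => 0, []⟩
      ⟨none, fun _ => [], fun _ => 0, y⟩ t) :
    Nonempty (Turing.TM2OutputsInTime p.computer.tm (x.map p.computer.inputAlphabet.symm)
      (some (y.map p.computer.outputAlphabet.symm)) t) := by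
  obtain ⟨a, ha, h⟩ := h.exec (p.code id .halt) id .halt fun _ => rfl
  have hx : x.map p.computer.inputAlphabet.symm = x := List.map_id x
  have hy : y.map p.computer.outputAlphabet.symm = y := List.map_id y
  rw [hx, hy]
  refine ⟨⟨⟨a, ?_⟩, ha⟩⟩
  refine Eq.trans ?_ (h.trans ?_)
  · refine congrArg _ (congrArg some ?_)
    refine congrArg (Turing.TM2.Cfg.mk (some p.entry) none) ?_
    funext k
    rcases k with b | c | _
    · cases b <;> rfl
    · rfl
    · rfl
  · refine congrArg some ?_
    refine congrArg (Turing.TM2.Cfg.mk none none) ?_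
    funext k
    rcases k with b | c | _ <;> rfl

/-! ### Emission of quantum gates -/

/-- The description of a gate. -/
def WireGate.encode : WireGate ℕ → List ProgramSymbol
  | .one u q => .one u :: ProgramSymbol.unary q
  | .csign a b => .csign :: (ProgramSymbol.unary a ++ ProgramSymbol.unary b)

namespace Prog

/-- Prepend the value of a counter to the output, in unary. -/
def emitCounter (c : Counter) : Prog :=
  .seq (.dec c) (.seq (.loop Option.isSome (.seq (.emit .tick) (.seq (.inc .temp) (.dec c))))
    (.seq (.dec .temp) (.loop Option.isSome (.seq (.inc c) (.dec .temp)))))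

/-- Prepend the qubit of a port to the output, in unary. -/
def emitPort : Port → Prog
  | .scratch => .clear
  | .target => emitCounter .target
  | .left => emitCounter .left
  | .right => emitCounter .right

/-- Prepend a gate to the output. -/
def emitGate : WireGate Port → Prog
  | .one u q => .seq (.emit .sep) (.seq (emitPort q) (.emit (.one u)))
  | .csign a b => .seq (.emit .sep) (.seq (emitPort b)
      (.seq (.emit .sep) (.seq (emitPort a) (.emit .csign))))

/-- Prepend a list of gates to the output. -/
def emitGates : List (WireGate Port) → Prog
  | [] => .clear
  | g :: gs => .seq (emitGates gs) (emitGate g)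

/-- Read a numeral and add it, plus one, to a counter. -/
def load (b : Bool) (c : Counter) : Prog :=
  .seq (.inc c) (.seq (.read b)
    (.loop (fun r => decide (r = some .tick)) (.seq (.inc c) (.read b))))

/-- Write the predecessor of a counter as a numeral, and clear the counter. -/
def save (b : Bool) (c : Counter) : Prog :=
  .seq (.dec c) (.seq (.write b .sep) (.seq (.dec c)
    (.loop Option.isSome (.seq (.write b .tick) (.dec c)))))

/-- Treat a constant gate. -/
def constGate (b v : Bool) : Prog :=
  .seq (emitGates (BoolGate.const v).block) (.write (!b) (.const v))

/-- Treat a negation. -/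
def notGate (b : Bool) : Prog :=
  .seq (load b .left) (.seq (emitGates (BoolGate.not 0).block)
    (.seq (save (!b) .left) (.write (!b) .not)))

/-- Treat a binary gate with block `L` and name `a`. -/
def binaryGate (b : Bool) (L : List (WireGate Port)) (a : CircuitSymbol) : Prog :=
  .seq (load b .left) (.seq (load b .right) (.seq (emitGates L)
    (.seq (save (!b) .right) (.seq (save (!b) .left) (.write (!b) a)))))

/-- Treat a gate whose name is in the register: read its wires from the stack `b`, prepend its block
to the output, and write it to the other stack. -/
def treatGate (b : Bool) : Prog :=
  .ite (fun r => decide (r = some (.const false))) (constGate b false)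
    (.ite (fun r => decide (r = some (.const true))) (constGate b true)
      (.ite (fun r => decide (r = some .not)) (notGate b)
        (.ite (fun r => decide (r = some .and)) (binaryGate b (BoolGate.and 0 0).block .and)
          (binaryGate b (BoolGate.or 0 0).block .or))))

/-- Read the number of inputs, with a Hadamard gate for each. -/
def readInputs : Prog :=
  .seq (.read false) (.loop (fun r => decide (r = some .tick))
    (.seq (.inc .target) (.seq (emitGates [.one .H .target]) (.read false))))

/-- Read the gates in order. -/
def forwardPass : Prog :=
  .seq (.read false) (.loop (fun r => !decide (r = some .out))
    (.seq (treatGate false) (.seq (.inc .target) (.read false))))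

/-- Read the gates in reverse order. -/
def backwardPass : Prog :=
  .seq (.read true) (.loop Option.isSome
    (.seq (treatGate true) (.seq (.dec .target) (.seq (.inc .total) (.read true)))))

/-- Read the output wire, with a sign for it. -/
def readOutput : Prog :=
  .seq (load false .left) (.seq (emitGates [.one .Z .left])
    (.seq (.dec .left) (.loop Option.isSome (.dec .left))))

/-- A Hadamard gate for each input. -/
def writeInputs : Prog :=
  .seq (.dec .target) (.loop Option.isSome (.seq (.inc .target)
    (.seq (emitGates [.one .H .target]) (.seq (.dec .target) (.seq (.inc .total) (.dec .target))))))

/-- Clear the input stack. -/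
def clearInput : Prog := .seq (.read false) (.loop Option.isSome (.read false))

/-- Prepend the number of qubits. -/
def writeTotal : Prog :=
  .seq (.inc .total) (.seq (.emit .sep) (.seq (.dec .total)
    (.loop Option.isSome (.seq (.emit .tick) (.dec .total)))))

/-- The compiler of classical circuits to quantum circuits. -/
def compiler : Prog :=
  .seq readInputs (.seq (.inc .target) (.seq forwardPass (.seq (.dec .target) (.seq readOutput
    (.seq backwardPass (.seq writeInputs (.seq clearInput writeTotal)))))))

end Prog

/-- The qubits named by the counters. -/
def Store.port (s : Store) : Port → ℕ
  | .scratch => 0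
  | .target => s.cnt .target
  | .left => s.cnt .left
  | .right => s.cnt .right

theorem Store.cnt_update_self (f : Counter → ℕ) {c : Counter} {x : ℕ} (h : f c = x) :
    update f c x = f := by
  rw [← h, update_eq_self]

/-- The loop test is the result of the preceding decrement, so the invariant has one unit already
removed: `x` units remain to be copied, the counter shows `x - 1`, and the register tells whether
`x` is zero. The other counter loops follow this pattern. -/
theorem runs_emitCounter_copy (c : Counter) (hc : c ≠ .temp) (x : ℕ)
    (src : Bool → List CircuitSymbol) (f : Counter → ℕ) (o : List ProgramSymbol) (r : Option CircuitSymbol)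
    (hr : r = if x = 0 then none else some .tick) (hf : f c = x - 1) :
    Runs (.loop Option.isSome (.seq (.emit .tick) (.seq (.inc .temp) (.dec c)))) ⟨r, src, f, o⟩
      ⟨none, src, update (update f c 0) .temp (f .temp + x), List.replicate x .tick ++ o⟩
      (4 * x + 1) := by
  induction x generalizing f o r with
  | zero =>
    subst hr
    refine (Runs.loop_false rfl).cast ?_ le_rfl
    congr
    funext d
    by_cases h1 : d = .temp
    · subst h1; simp
    · by_cases h2 : d = c
      · subst h2; simp [h1, hf]
      · simp [h1, h2]
  | succ x ih =>
    subst hr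
    have hf' : f c = x := hf
    refine (Runs.loop_true rfl (.seq (.emit _ _) (.seq (.inc _ _) (.dec _ _))) (ih _ _ _ ?_ ?_)).cast
      ?_ (by omega)
    · simp [hc, hf']
    · simp [hc, hf']
    · congr 1
      · funext d
        by_cases h1 : d = .temp
        · subst h1; simp [hc.symm]; omega
        · by_cases h2 : d = c
          · subst h2; simp [h1]
          · simp [h1, h2]
      · simp [List.replicate_succ']

theorem runs_emitCounter_restore (c : Counter) (hc : c ≠ .temp) (x : ℕ)
    (src : Bool → List CircuitSymbol)
    (f : Counter → ℕ) (o : List ProgramSymbol) (r : Option CircuitSymbol)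
    (hr : r = if x = 0 then none else some .tick) (hf : f .temp = x - 1) :
    Runs (.loop Option.isSome (.seq (.inc c) (.dec .temp))) ⟨r, src, f, o⟩
      ⟨none, src, update (update f .temp 0) c (f c + x), o⟩ (3 * x + 1) := by
  induction x generalizing f r with
  | zero =>
    subst hr
    refine (Runs.loop_false rfl).cast ?_ le_rfl
    congr
    funext d
    by_cases h1 : d = c
    · subst h1; simp
    · by_cases h2 : d = .temp
      · subst h2; simp [h1, hf]
      · simp [h1, h2]
  | succ x ih =>
    subst hr
    have hf' : f .temp = x := hf
    refine (Runs.loop_true rfl (.seq (.inc _ _) (.dec _ _)) (ih _ _ ?_ ?_)).cast ?_ (by omega)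
    · simp [hc.symm, hf']
    · simp [hc.symm, hf']
    · congr 1
      funext d
      by_cases h1 : d = c
      · subst h1; simp [hc]; omega
      · by_cases h2 : d = .temp
        · subst h2; simp [h1]
        · simp [h1, h2]

/-- Emitting a counter destroys it, so it is saved in the temporary counter and moved back. -/
theorem runs_emitCounter (c : Counter) (hc : c ≠ .temp) (s : Store) (ht : s.cnt .temp = 0) :
    Runs (Prog.emitCounter c) s ⟨none, s.src, s.cnt, List.replicate (s.cnt c) .tick ++ s.out⟩
      (7 * s.cnt c + 4) := by
  refine (Runs.seq (.dec c s) (.seq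
    (runs_emitCounter_copy c hc (s.cnt c) _ _ _ _ rfl (by simp))
    (.seq (.dec _ _) (runs_emitCounter_restore c hc (s.cnt c) _ _ _ _ ?_ ?_)))).cast ?_ (by omega)
  · simp [hc.symm, ht]
  · simp [hc.symm, ht]
  · congr 1
    funext d
    by_cases h1 : d = c
    · subst h1; simp [hc]
    · by_cases h2 : d = .temp
      · subst h2; simp [h1, ht]
      · simp [h1, h2]

theorem runs_emitPort (p : Port) (s : Store) (ht : s.cnt .temp = 0) {N : ℕ}
    (hN : ∀ c, s.cnt c ≤ N) :
    Runs (Prog.emitPort p) s ⟨none, s.src, s.cnt, List.replicate (s.port p) .tick ++ s.out⟩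
      (7 * N + 4) := by
  cases p with
  | scratch => exact (Runs.clear s).cast rfl (by omega)
  | target =>
    exact (runs_emitCounter .target (by decide) s ht).cast rfl (by have := hN .target; omega)
  | left => exact (runs_emitCounter .left (by decide) s ht).cast rfl (by have := hN .left; omega)
  | right =>
    exact (runs_emitCounter .right (by decide) s ht).cast rfl (by have := hN .right; omega)

/-- The bound is that of a CSIGN: two numerals at `7 * N + 4` each and three single symbols. -/
theorem runs_emitGate (g : WireGate Port) (s : Store) (ht : s.cnt .temp = 0) {N : ℕ}
    (hN : ∀ c, s.cnt c ≤ N) :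
    Runs (Prog.emitGate g) s ⟨none, s.src, s.cnt, (g.map s.port).encode ++ s.out⟩
      (14 * N + 11) := by
  cases g with
  | one u q =>
    refine (Runs.seq (.emit _ _) (.seq (runs_emitPort (N := N) q
      ⟨none, s.src, s.cnt, _⟩ ht hN) (.emit _ _))).cast ?_ (by omega)
    simp [WireGate.map, WireGate.encode, ProgramSymbol.unary, Store.port.eq_def]
  | csign a b =>
    refine (Runs.seq (.emit _ _) (.seq (runs_emitPort (N := N) b
      ⟨none, s.src, s.cnt, _⟩ ht hN) (.seq (.emit _ _)
      (.seq (runs_emitPort (N := N) a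
      ⟨none, s.src, s.cnt, _⟩ ht hN) (.emit _ _))))).cast ?_ (by omega)
    simp [WireGate.map, WireGate.encode, ProgramSymbol.unary, Store.port.eq_def]

theorem runs_emitGates (L : List (WireGate Port)) (s : Store) (ht : s.cnt .temp = 0) {N : ℕ}
    (hN : ∀ c, s.cnt c ≤ N) :
    Runs (Prog.emitGates L) s
      ⟨none, s.src, s.cnt, (L.map (WireGate.map s.port)).flatMap WireGate.encode ++ s.out⟩
      (L.length * (14 * N + 11) + 1) := by
  induction L with
  | nil => exact (Runs.clear s).cast rfl (by omega)
  | cons g L ih =>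
    refine (Runs.seq ih (runs_emitGate (N := N) g ⟨none, s.src, s.cnt, _⟩ ht hN)).cast ?_
      (by rw [List.length_cons, Nat.add_one_mul L.length]; omega)
    simp only [List.map_cons, List.flatMap_cons, List.append_assoc]
    congr 3

/-! ### Numerals -/

/-- The counter gains `x + 1` because wire `x` lives in qubit `x + 1`; `Prog.save` undoes this
shift. -/
theorem runs_load (b : Bool) (c : Counter) (x : ℕ) (s : Store) (l : List CircuitSymbol)
    (hs : s.src b = CircuitSymbol.unary x ++ l) :
    Runs (Prog.load b c) s
      ⟨some .sep, update s.src b l, update s.cnt c (s.cnt c + (x + 1)), s.out⟩ (3 * x + 3) := by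
  -- The unread text `k` is split by the look-ahead: its head is in the register and its tail on the
  -- stack.
  have key : ∀ (x : ℕ) (src : Bool → List CircuitSymbol) (f : Counter → ℕ) (k : List CircuitSymbol),
      k = CircuitSymbol.unary x ++ l → src b = k.tail →
      Runs (.loop (fun r => decide (r = some .tick)) (.seq (.inc c) (.read b)))
        ⟨k.head?, src, f, s.out⟩ ⟨some .sep, update src b l, update f c (f c + x), s.out⟩
          (3 * x + 1) := by
    intro x
    induction x with
    | zero =>
      intro src f k hk hsrc
      subst hk
      refine (Runs.loop_false rfl).cast ?_ le_rfl
      have hsrc : src b = l := hsrc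
      simp [CircuitSymbol.unary, ← hsrc]
    | succ x ih =>
      intro src f k hk hsrc
      subst hk
      have hsrc : src b = CircuitSymbol.unary x ++ l := hsrc
      refine (Runs.loop_true rfl (.seq (.inc _ _) ((Runs.read _ _).cast ?_ le_rfl))
        (ih (update src b (CircuitSymbol.unary x ++ l).tail) (update f c (f c + 1))
          (CircuitSymbol.unary x ++ l) rfl (by simp))).cast ?_ (by omega)
      · simp [hsrc]
      · simp [add_assoc, add_comm 1]
  refine (Runs.seq (.inc _ _) (.seq ((Runs.read _ _).cast ?_ le_rfl)
    (key x (update s.src b (CircuitSymbol.unary x ++ l).tail) (update s.cnt c (s.cnt c + 1))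
      (CircuitSymbol.unary x ++ l) rfl (by simp)))).cast ?_ (by omega)
  · simp [hs]
  · simp [add_assoc, add_comm 1]

theorem runs_save (b : Bool) (c : Counter) (x : ℕ) (s : Store) (hs : s.cnt c = x + 1) :
    Runs (Prog.save b c) s
      ⟨none, update s.src b (CircuitSymbol.unary x ++ s.src b), update s.cnt c 0, s.out⟩
      (3 * x + 4) := by
  have key : ∀ (x : ℕ) (src : Bool → List CircuitSymbol) (f : Counter → ℕ), f c = x - 1 →
      Runs (.loop Option.isSome (.seq (.write b .tick) (.dec c)))
        ⟨if x = 0 then none else some .tick, src, f, s.out⟩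
        ⟨none, update src b (List.replicate x .tick ++ src b), update f c 0, s.out⟩
          (3 * x + 1) := by
    intro x
    induction x with
    | zero =>
      intro src f hf
      refine (Runs.loop_false rfl).cast ?_ le_rfl
      simp [Store.cnt_update_self f hf]
    | succ x ih =>
      intro src f hf
      have hf : f c = x := hf
      refine (Runs.loop_true rfl (.seq (.write _ _ _) ((Runs.dec _ _).cast ?_ le_rfl))
        (ih (update src b (.tick :: src b)) (update f c (x - 1)) (by simp))).cast ?_ (by omega)
      · simp [hf]
      · simp [List.replicate_succ']
  refine (Runs.seq (.dec _ _) (.seq (.write _ _ _) (.seq ((Runs.dec _ _).cast ?_ le_rfl)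
    (key x (update s.src b (.sep :: s.src b)) (update s.cnt c (x - 1)) (by simp))))).cast
      ?_ (by omega)
  · simp [hs]
  · simp [CircuitSymbol.unary]

/-! ### The passes of the compiler -/

/-- The contents of the two stacks of circuit symbols. -/
def stackPair (b : Bool) (x y : List CircuitSymbol) : Bool → List CircuitSymbol :=
  fun c => if c = b then x else y

/-- The values of the counters, the temporary one being clear. -/
def counters (t l r n : ℕ) : Counter → ℕ
  | .target => t
  | .left => l
  | .right => r
  | .total => n
  | .temp => 0

section Counters

variable (b : Bool) (x y z : List CircuitSymbol) (t l r n k : ℕ)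

@[simp] theorem stackPair_self : stackPair b x y b = x := by simp [stackPair]

@[simp] theorem stackPair_not : stackPair b x y (!b) = y := by simp [stackPair]

@[simp] theorem update_stackPair_self : update (stackPair b x y) b z = stackPair b z y := by
  funext c
  by_cases h : c = b
  · subst h; simp
  · simp [stackPair, h]

@[simp] theorem update_stackPair_not : update (stackPair b x y) (!b) z = stackPair b x z := by
  funext c
  by_cases h : c = b
  · subst h; simp [stackPair]
  · have : c = !b := by revert h; cases b <;> cases c <;> simp
    subst this
    simp

theorem stackPair_swap : stackPair true x y = stackPair false y x := by
  funext c
  cases c <;> rfl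

@[simp] theorem counters_target : counters t l r n .target = t := rfl
@[simp] theorem counters_left : counters t l r n .left = l := rfl
@[simp] theorem counters_right : counters t l r n .right = r := rfl
@[simp] theorem counters_total : counters t l r n .total = n := rfl
@[simp] theorem counters_temp : counters t l r n .temp = 0 := rfl

@[simp] theorem update_counters_target :
    update (counters t l r n) .target k = counters k l r n := by
  funext c; cases c <;> rfl

@[simp] theorem update_counters_left :
    update (counters t l r n) .left k = counters t k r n := by
  funext c; cases c <;> rfl

@[simp] theorem update_counters_right :
    update (counters t l r n) .right k = counters t l k n := by
  funext c; cases c <;> rfl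

@[simp] theorem update_counters_total :
    update (counters t l r n) .total k = counters t l r k := by
  funext c; cases c <;> rfl

theorem counters_le {N : ℕ} (ht : t ≤ N) (hl : l ≤ N) (hr : r ≤ N) (hn : n ≤ N) :
    ∀ c, counters t l r n c ≤ N := by
  intro c
  cases c <;> simp [*]

end Counters

/-- The name of a gate. -/
def BoolGate.symbol : BoolGate → CircuitSymbol
  | .const b => .const b
  | .not _ => .not
  | .and _ _ => .and
  | .or _ _ => .or

/-- The numerals in the description of a gate. -/
def BoolGate.arguments : BoolGate → List CircuitSymbol
  | .const _ => []
  | .not a => CircuitSymbol.unary a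
  | .and a b => CircuitSymbol.unary a ++ CircuitSymbol.unary b
  | .or a b => CircuitSymbol.unary a ++ CircuitSymbol.unary b

theorem BoolGate.encode_eq (g : BoolGate) : g.encode = g.symbol :: g.arguments := by
  cases g <;> rfl

/-- The longest block is that of a disjunction: 45 gates for `addMul` and 6 for two CNOTs. -/
theorem BoolGate.length_block_le (g : BoolGate) : g.block.length ≤ 51 := by
  cases g with
  | const b => cases b <;> decide
  | not _ => simp [BoolGate.block, cnot]
  | and _ _ => simp [BoolGate.block, addMul, toffoli, ccsign, cnot]
  | or _ _ => simp [BoolGate.block, addMul, toffoli, ccsign, cnot]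

theorem runs_emitGates_counters (L : List (WireGate Port)) {N : ℕ} (hL : L.length ≤ 51)
    (v : Option CircuitSymbol) (src : Bool → List CircuitSymbol) {t l r n : ℕ}
    (o : List ProgramSymbol) (ht : t ≤ N) (hl : l ≤ N) (hr : r ≤ N) (hn : n ≤ N) :
    Runs (Prog.emitGates L) ⟨v, src, counters t l r n, o⟩
      ⟨none, src, counters t l r n, (L.map (WireGate.map
        (Store.port ⟨v, src, counters t l r n, o⟩))).flatMap WireGate.encode ++ o⟩
      (714 * N + 562) := by
  refine (runs_emitGates (N := N) L ⟨v, src, counters t l r n, o⟩ rfl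
    (counters_le _ _ _ _ ht hl hr hn)).cast rfl ?_
  -- The constants come from 51 * 14 = 714 and 51 * 11 + 1 = 562.
  have := Nat.mul_le_mul_right (14 * N + 11) hL
  omega

theorem runs_binaryGate (b : Bool) (g : BoolGate) (a : CircuitSymbol) (v : Option CircuitSymbol)
    (i j : ℕ)
    {N t n : ℕ} (x y : List CircuitSymbol) (o : List ProgramSymbol) (ht : t ≤ N) (hn : n ≤ N)
    (hg : g.inputs = [i, j]) (hi : i < N) (hj : j < N) :
    Runs (Prog.binaryGate b g.block a)
      ⟨v, stackPair b (CircuitSymbol.unary i ++ (CircuitSymbol.unary j ++ x)) y,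
        counters t 0 0 n, o⟩
      ⟨none, stackPair b x (a :: (CircuitSymbol.unary i ++ (CircuitSymbol.unary j ++ y))),
        counters t 0 0 n, (g.blockAt t).flatMap WireGate.encode ++ o⟩ (1000 * (N + 1)) := by
  have h1 := (runs_load b .left i
    ⟨v, stackPair b (CircuitSymbol.unary i ++ (CircuitSymbol.unary j ++ x)) y,
      counters t 0 0 n, o⟩ (CircuitSymbol.unary j ++ x) (by simp)).cast
    (s'' := ⟨some .sep, stackPair b (CircuitSymbol.unary j ++ x) y, counters t (i + 1) 0 n, o⟩)
    (by simp) le_rfl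
  have h2 := (runs_load b .right j _ x (stackPair_self b _ _)).cast
    (s := ⟨some .sep, stackPair b (CircuitSymbol.unary j ++ x) y, counters t (i + 1) 0 n, o⟩)
    (s'' := ⟨some .sep, stackPair b x y, counters t (i + 1) (j + 1) n, o⟩)
    (by simp) le_rfl
  have h3 := runs_emitGates_counters (N := N) g.block g.length_block_le (some .sep)
    (stackPair b x y) (t := t) (l := i + 1) (r := j + 1) (n := n) o ht (by omega) (by omega) hn
  -- The loaded counters are exactly the qubits of the gate, so the emitted block is `g.blockAt t`.
  have hp : Store.port ⟨some .sep, stackPair b x y, counters t (i + 1) (j + 1) n, o⟩ =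
      g.qubit t := by
    funext p
    cases p <;> simp [Store.port, BoolGate.qubit, hg]
  rw [hp] at h3
  -- The right numeral is pushed first, so that the copy on the other stack again reads name, left,
  -- right.
  have h4 := (runs_save (!b) .right j ⟨none, stackPair b x y, counters t (i + 1) (j + 1) n,
    (g.blockAt t).flatMap WireGate.encode ++ o⟩ rfl).cast
      (s'' := ⟨none, stackPair b x (CircuitSymbol.unary j ++ y), counters t (i + 1) 0 n,
        (g.blockAt t).flatMap WireGate.encode ++ o⟩) (by simp) le_rfl
  have h5 := (runs_save (!b) .left i ⟨none, stackPair b x (CircuitSymbol.unary j ++ y),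
    counters t (i + 1) 0 n, (g.blockAt t).flatMap WireGate.encode ++ o⟩ rfl).cast
      (s'' := ⟨none, stackPair b x (CircuitSymbol.unary i ++ (CircuitSymbol.unary j ++ y)),
        counters t 0 0 n, (g.blockAt t).flatMap WireGate.encode ++ o⟩) (by simp) le_rfl
  exact (Runs.seq h1 (.seq h2 (.seq h3 (.seq h4 (.seq h5 (.write _ _ _)))))).cast (by simp)
    (by omega)

theorem runs_notGate (b : Bool) (v : Option CircuitSymbol) (i : ℕ)
    {N t n : ℕ} (x y : List CircuitSymbol) (o : List ProgramSymbol) (ht : t ≤ N) (hn : n ≤ N)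
    (hi : i < N) :
    Runs (Prog.notGate b)
      ⟨v, stackPair b (CircuitSymbol.unary i ++ x) y, counters t 0 0 n, o⟩
      ⟨none, stackPair b x (.not :: (CircuitSymbol.unary i ++ y)),
        counters t 0 0 n, ((BoolGate.not i).blockAt t).flatMap WireGate.encode ++ o⟩
      (1000 * (N + 1)) := by
  have h1 := (runs_load b .left i
    ⟨v, stackPair b (CircuitSymbol.unary i ++ x) y, counters t 0 0 n, o⟩ x (by simp)).cast
    (s'' := ⟨some .sep, stackPair b x y, counters t (i + 1) 0 n, o⟩) (by simp) le_rfl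
  have h3 := runs_emitGates_counters (N := N) (BoolGate.not 0).block
    (BoolGate.length_block_le _) (some .sep) (stackPair b x y) (t := t) (l := i + 1) (r := 0)
    (n := n) o ht (by omega) (by omega) hn
  have h4 := (runs_save (!b) .left i ⟨none, stackPair b x y,
    counters t (i + 1) 0 n, ((BoolGate.not i).blockAt t).flatMap WireGate.encode ++ o⟩ rfl).cast
      (s'' := ⟨none, stackPair b x (CircuitSymbol.unary i ++ y),
        counters t 0 0 n, ((BoolGate.not i).blockAt t).flatMap WireGate.encode ++ o⟩)
      (by simp) le_rfl
  exact (Runs.seq h1 (.seq h3 (.seq h4 (.write _ _ _)))).cast (by simp) (by omega)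

theorem runs_constGate (b c : Bool) (v : Option CircuitSymbol)
    {N t n : ℕ} (x y : List CircuitSymbol) (o : List ProgramSymbol) (ht : t ≤ N) (hn : n ≤ N) :
    Runs (Prog.constGate b c) ⟨v, stackPair b x y, counters t 0 0 n, o⟩
      ⟨none, stackPair b x (.const c :: y),
        counters t 0 0 n, ((BoolGate.const c).blockAt t).flatMap WireGate.encode ++ o⟩
      (1000 * (N + 1)) := by
  have h3 := (runs_emitGates_counters (N := N) (BoolGate.const c).block
    (BoolGate.length_block_le _) v (stackPair b x y) (t := t) (l := 0) (r := 0)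
    (n := n) o ht (by omega) (by omega) hn).cast
      (s'' := ⟨none, stackPair b x y,
        counters t 0 0 n, ((BoolGate.const c).blockAt t).flatMap WireGate.encode ++ o⟩)
      (by cases c <;> rfl) le_rfl
  exact (Runs.seq h3 (.write _ _ _)).cast (by simp) (by omega)

/-- A block does not depend on wire numbers, so the dummy wires 0 in `Prog.treatGate` give
definitionally the block of `g`. -/
theorem runs_treatGate (b : Bool) (g : BoolGate) {N t n : ℕ} (x y : List CircuitSymbol)
    (o : List ProgramSymbol) (ht : t ≤ N) (hn : n ≤ N) (hg : ∀ a ∈ g.inputs, a < N) :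
    Runs (Prog.treatGate b)
      ⟨some g.symbol, stackPair b (g.arguments ++ x) y, counters t 0 0 n, o⟩
      ⟨none, stackPair b x (g.encode ++ y),
        counters t 0 0 n, (g.blockAt t).flatMap WireGate.encode ++ o⟩ (1000 * (N + 1) + 4) := by
  cases g with
  | const c =>
    have := runs_constGate b c (some (.const c)) x y o ht hn
    cases c with
    | false => exact (Runs.ite_true rfl this).weaken (by omega)
    | true => exact (Runs.ite_false rfl (.ite_true rfl this)).weaken (by omega)
  | not i =>
    have := runs_notGate b (some .not) i x y o ht hn (hg i (by simp [BoolGate.inputs]))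
    exact (Runs.ite_false rfl (.ite_false rfl (.ite_true rfl this))).weaken (by omega)
  | and i j =>
    have := runs_binaryGate b (BoolGate.and i j) .and (some .and) i j x y o ht hn rfl
      (hg i (by simp [BoolGate.inputs])) (hg j (by simp [BoolGate.inputs]))
    rw [← List.append_assoc, ← List.append_assoc] at this
    exact (Runs.ite_false rfl (.ite_false rfl (.ite_false rfl (.ite_true rfl this)))).weaken
      (by omega)
  | or i j =>
    have := runs_binaryGate b (BoolGate.or i j) .or (some .or) i j x y o ht hn rfl
      (hg i (by simp [BoolGate.inputs])) (hg j (by simp [BoolGate.inputs]))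
    rw [← List.append_assoc, ← List.append_assoc] at this
    exact (Runs.ite_false rfl (.ite_false rfl (.ite_false rfl (.ite_false rfl this)))).weaken
      (by omega)

/-- Blocks are prepended, so reading the gates in order writes the uncomputation, while their
descriptions pile up in reverse on the other stack. -/
theorem runs_forwardPass (gs : List BoolGate) {N t n : ℕ} (v : Option CircuitSymbol)
    (x y : List CircuitSymbol)
    (o : List ProgramSymbol) (ht : t + gs.length ≤ N) (hn : n ≤ N)
    (hg : ∀ g ∈ gs, ∀ a ∈ g.inputs, a < N) :
    Runs Prog.forwardPass
      ⟨v, stackPair false (gs.flatMap BoolGate.encode ++ .out :: x) y, counters t 0 0 n, o⟩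
      ⟨some .out, stackPair false x (gs.reverse.flatMap BoolGate.encode ++ y),
        counters (t + gs.length) 0 0 n, (uncomputeBlocks t gs).flatMap WireGate.encode ++ o⟩
      (gs.length * (1000 * (N + 1) + 7) + 2) := by
  have key : ∀ (gs : List BoolGate) (t : ℕ) (y : List CircuitSymbol) (o : List ProgramSymbol)
      (_ : t + gs.length ≤ N) (_ : ∀ g ∈ gs, ∀ a ∈ g.inputs, a < N) (k : List CircuitSymbol)
      (_ : k = gs.flatMap BoolGate.encode ++ .out :: x),
      Runs (.loop (fun r => !decide (r = some .out))
          (.seq (Prog.treatGate false) (.seq (.inc .target) (.read false))))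
        ⟨k.head?, stackPair false k.tail y, counters t 0 0 n, o⟩
        ⟨some .out, stackPair false x (gs.reverse.flatMap BoolGate.encode ++ y),
          counters (t + gs.length) 0 0 n, (uncomputeBlocks t gs).flatMap WireGate.encode ++ o⟩
        (gs.length * (1000 * (N + 1) + 7) + 1) := by
    intro gs
    induction gs with
    | nil =>
      intro t y o _ _ k hk
      subst hk
      exact (Runs.loop_false rfl).cast rfl (by omega)
    | cons g gs ih =>
      intro t y o ht hg k hk
      rw [List.length_cons] at ht
      have h1 := runs_treatGate false g (gs.flatMap BoolGate.encode ++ .out :: x) y o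
        (N := N) (t := t) (by omega) hn (hg g (by simp))
      have h2 := ih (t + 1) (g.encode ++ y) ((g.blockAt t).flatMap WireGate.encode ++ o)
        (by omega) (fun g' h' => hg g' (by simp [h'])) _ rfl
      have hk' : k = g.symbol :: (g.arguments ++ (gs.flatMap BoolGate.encode ++ .out :: x)) := by
        rw [hk, List.flatMap_cons, BoolGate.encode_eq]
        simp
      subst hk'
      refine (Runs.loop_true (by cases g <;> rfl) (Runs.seq h1 (.seq (.inc _ _)
        ((Runs.read _ _).cast ?_ le_rfl))) h2).cast ?_
        (by rw [List.length_cons, Nat.add_one_mul gs.length]; omega)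
      · simp
      · simp [uncomputeBlocks, add_assoc, add_comm 1]
  refine (Runs.seq ((Runs.read _ _).cast ?_ le_rfl) (key gs t y o ht hg _ rfl)).cast rfl
    (by omega)
  simp

theorem computeBlocks_concat (gs : List BoolGate) (g : BoolGate) (t : ℕ) :
    computeBlocks t (gs ++ [g]) = computeBlocks t gs ++ g.blockAt (t + gs.length) := by
  induction gs generalizing t with
  | nil => simp [computeBlocks]
  | cons g' gs ih => simp [computeBlocks, ih, add_assoc, add_comm 1]

/-- The pile returns the gates from last to first, and prepending their blocks writes the
computation in order. The target starts at the qubit of the last gate, and `total` counts the gates.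
-/
theorem runs_backwardPass (gs : List BoolGate) {N t n : ℕ} (v : Option CircuitSymbol)
    (y : List CircuitSymbol)
    (o : List ProgramSymbol) (ht : t + gs.length ≤ N) (hn : n + gs.length ≤ N)
    (hg : ∀ g ∈ gs, ∀ a ∈ g.inputs, a < N) :
    Runs Prog.backwardPass
      ⟨v, stackPair true (gs.reverse.flatMap BoolGate.encode) y,
        counters (t + gs.length) 0 0 n, o⟩
      ⟨none, stackPair true [] (gs.flatMap BoolGate.encode ++ y),
        counters t 0 0 (n + gs.length),
        (computeBlocks (t + 1) gs).flatMap WireGate.encode ++ o⟩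
      (gs.length * (1000 * (N + 1) + 8) + 2) := by
  have key : ∀ (gs : List BoolGate) (n : ℕ) (y : List CircuitSymbol) (o : List ProgramSymbol)
      (_ : t + gs.length ≤ N) (_ : n + gs.length ≤ N) (_ : ∀ g ∈ gs, ∀ a ∈ g.inputs, a < N)
      (k : List CircuitSymbol) (_ : k = gs.reverse.flatMap BoolGate.encode),
      Runs (.loop Option.isSome (.seq (Prog.treatGate true)
          (.seq (.dec .target) (.seq (.inc .total) (.read true)))))
        ⟨k.head?, stackPair true k.tail y, counters (t + gs.length) 0 0 n, o⟩
        ⟨none, stackPair true [] (gs.flatMap BoolGate.encode ++ y),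
          counters t 0 0 (n + gs.length),
          (computeBlocks (t + 1) gs).flatMap WireGate.encode ++ o⟩
        (gs.length * (1000 * (N + 1) + 8) + 1) := by
    intro gs
    -- The last gate is on top of the stack, so the induction removes it first.
    induction gs using List.reverseRecOn with
    | nil =>
      intro n y o _ _ _ k hk
      subst hk
      exact (Runs.loop_false rfl).cast rfl (by omega)
    | append_singleton gs g ih =>
      intro n y o ht hn hg k hk
      rw [List.length_append, List.length_singleton] at ht hn
      have h1 := runs_treatGate true g (gs.reverse.flatMap BoolGate.encode) y o
        (N := N) (t := t + (gs ++ [g]).length) (n := n) (by simpa using ht) (by omega)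
        (hg g (by simp))
      have h2 := ih (n + 1) (g.encode ++ y)
        ((g.blockAt (t + (gs ++ [g]).length)).flatMap WireGate.encode ++ o)
        (by omega) (by omega) (fun g' h' => hg g' (by simp [h'])) _ rfl
      have hk' : k = g.symbol :: (g.arguments ++ gs.reverse.flatMap BoolGate.encode) := by
        rw [hk, List.reverse_append, List.reverse_singleton, List.singleton_append,
          List.flatMap_cons, BoolGate.encode_eq]
        simp
      subst hk'
      refine (Runs.loop_true rfl (Runs.seq h1 (.seq (.dec _ _) (.seq (.inc _ _)
        ((Runs.read _ _).cast ?_ le_rfl)))) h2).cast ?_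
        (by rw [List.length_append, List.length_singleton, Nat.add_one_mul gs.length]; omega)
      · simp
      · simp [computeBlocks_concat, add_assoc, add_comm 1]
  refine (Runs.seq ((Runs.read _ _).cast ?_ le_rfl) (key gs n y o ht hn hg _ rfl)).cast rfl
    (by omega)
  simp

/-- Prepending with increasing targets yields the reversed layer, which closes the circuit. -/
theorem runs_readInputs (n : ℕ) (x y : List CircuitSymbol) (o : List ProgramSymbol)
    {N : ℕ} (hN : n ≤ N) :
    Runs Prog.readInputs
      ⟨none, stackPair false (CircuitSymbol.unary n ++ x) y, counters 0 0 0 0, o⟩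
      ⟨some .sep, stackPair false x y, counters n 0 0 0,
        (hadamards n).reverse.flatMap WireGate.encode ++ o⟩ (n * (1000 * (N + 1) + 3) + 2) := by
  have key : ∀ (j t : ℕ) (_ : t + j ≤ N) (k : List CircuitSymbol)
      (_ : k = CircuitSymbol.unary j ++ x),
      Runs (.loop (fun r => decide (r = some .tick))
          (.seq (.inc .target) (.seq (Prog.emitGates [.one .H .target]) (.read false))))
        ⟨k.head?, stackPair false k.tail y, counters t 0 0 0,
          (hadamards t).reverse.flatMap WireGate.encode ++ o⟩
        ⟨some .sep, stackPair false x y, counters (t + j) 0 0 0,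
          (hadamards (t + j)).reverse.flatMap WireGate.encode ++ o⟩
        (j * (1000 * (N + 1) + 3) + 1) := by
    intro j
    induction j with
    | zero =>
      intro t _ k hk
      subst hk
      exact (Runs.loop_false rfl).cast rfl (by omega)
    | succ j ih =>
      intro t ht k hk
      subst hk
      have h2 := ih (t + 1) (by omega) _ rfl
      have h1 := (runs_emitGates_counters (N := N) [.one .H .target] (by simp) none
        (stackPair false (CircuitSymbol.unary j ++ x) y) (t := t + 1) (l := 0) (r := 0) (n := 0)
        ((hadamards t).reverse.flatMap WireGate.encode ++ o) (by omega) (by omega) (by omega)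
        (by omega)).cast (s'' := ⟨none, stackPair false (CircuitSymbol.unary j ++ x) y,
          counters (t + 1) 0 0 0, (hadamards (t + 1)).reverse.flatMap WireGate.encode ++ o⟩)
        (by simp [hadamards, Store.port, WireGate.map]) le_rfl
      refine (Runs.loop_true rfl (.seq ((Runs.inc _ _).cast ?_ le_rfl)
        (.seq h1 ((Runs.read _ _).cast ?_ le_rfl))) h2).cast ?_
        (by rw [Nat.add_one_mul j]; omega)
      · simp [CircuitSymbol.unary, List.replicate_succ]
      · simp
      · simp [add_assoc, add_comm 1]
  refine (Runs.seq ((Runs.read _ _).cast ?_ le_rfl) (key n 0 (by omega) _ rfl)).cast ?_ (by omega)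
  · simp [hadamards]
  · simp

/-- Targets decrease here, so prepending yields the opening layer. Each round puts back the unit
taken by the loop test before emitting, and adds one input to `total`. -/
theorem runs_writeInputs (t : ℕ) (v : Option CircuitSymbol) (src : Bool → List CircuitSymbol)
    (n : ℕ) (o : List ProgramSymbol) {N : ℕ} (hN : n + t ≤ N) :
    Runs Prog.writeInputs ⟨v, src, counters t 0 0 n, o⟩
      ⟨none, src, counters 0 0 0 (n + t), (hadamards t).flatMap WireGate.encode ++ o⟩
      (t * (1000 * (N + 1) + 5) + 2) := by
  have key : ∀ (t n : ℕ) (o : List ProgramSymbol) (_ : n + t ≤ N),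
      Runs (.loop Option.isSome (.seq (.inc .target) (.seq (Prog.emitGates [.one .H .target])
          (.seq (.dec .target) (.seq (.inc .total) (.dec .target))))))
        ⟨if t = 0 then none else some .tick, src, counters (t - 1) 0 0 n, o⟩
        ⟨none, src, counters 0 0 0 (n + t), (hadamards t).flatMap WireGate.encode ++ o⟩
        (t * (1000 * (N + 1) + 5) + 1) := by
    intro t
    induction t with
    | zero =>
      intro n o _
      exact (Runs.loop_false rfl).cast rfl (by omega)
    | succ t ih =>
      intro n o h
      have h2 := ih (n + 1) (WireGate.encode (.one .H (t + 1)) ++ o) (by omega)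
      have h1 := (runs_emitGates_counters (N := N) [.one .H .target] (by simp) none src
        (t := t + 1) (l := 0) (r := 0) (n := n) o (by omega) (by omega) (by omega)
        (by omega)).cast (s'' := ⟨none, src, counters (t + 1) 0 0 n,
          WireGate.encode (.one .H (t + 1)) ++ o⟩) (by simp [Store.port, WireGate.map]) le_rfl
      refine (Runs.loop_true rfl (.seq ((Runs.inc _ _).cast ?_ le_rfl) (.seq h1
        (.seq (.dec _ _) (.seq (.inc _ _) ((Runs.dec _ _).cast ?_ le_rfl))))) h2).cast ?_
        (by rw [Nat.add_one_mul t]; omega)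
      · simp
      · simp
      · simp [hadamards, add_assoc, add_comm 1]
  exact (Runs.seq ((Runs.dec _ _).cast (by simp; rfl) le_rfl) (key t n o hN)).cast rfl (by omega)

theorem runs_readOutput (i : ℕ) (v : Option CircuitSymbol) (x y : List CircuitSymbol)
    {t n : ℕ} (o : List ProgramSymbol) {N : ℕ} (hi : i < N) (ht : t ≤ N) (hn : n ≤ N) :
    Runs Prog.readOutput
      ⟨v, stackPair false (CircuitSymbol.unary i ++ x) y, counters t 0 0 n, o⟩
      ⟨none, stackPair false x y, counters t 0 0 n, WireGate.encode (.one .Z (i + 1)) ++ o⟩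
      (1000 * (N + 1)) := by
  have h1 := (runs_load false .left i
    ⟨v, stackPair false (CircuitSymbol.unary i ++ x) y, counters t 0 0 n, o⟩ x (by simp)).cast
    (s'' := ⟨some .sep, stackPair false x y, counters t (i + 1) 0 n, o⟩) (by simp) le_rfl
  have h2 := (runs_emitGates_counters (N := N) [.one .Z .left] (by simp) (some .sep)
    (stackPair false x y) (t := t) (l := i + 1) (r := 0) (n := n) o ht (by omega) (by omega)
    hn).cast (s'' := ⟨none, stackPair false x y, counters t (i + 1) 0 n,
      WireGate.encode (.one .Z (i + 1)) ++ o⟩) (by simp [Store.port, WireGate.map]) le_rfl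
  have key : ∀ (i : ℕ) (src : Bool → List CircuitSymbol) (o : List ProgramSymbol),
      Runs (.loop Option.isSome (.dec .left))
        ⟨if i = 0 then none else some .tick, src, counters t (i - 1) 0 n, o⟩
        ⟨none, src, counters t 0 0 n, o⟩ (2 * i + 1) := by
    intro i src o
    induction i with
    | zero => exact (Runs.loop_false rfl).cast rfl (by omega)
    | succ i ih =>
      exact (Runs.loop_true rfl ((Runs.dec _ _).cast (by simp) le_rfl) ih).cast rfl (by omega)
  exact (Runs.seq h1 (.seq h2 (.seq ((Runs.dec _ _).cast (by simp) le_rfl)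
    (key (i + 1) _ _)))).cast rfl (by omega)

theorem runs_clearInput (x y : List CircuitSymbol) (v : Option CircuitSymbol) (f : Counter → ℕ)
    (o : List ProgramSymbol) :
    Runs Prog.clearInput ⟨v, stackPair false x y, f, o⟩ ⟨none, stackPair false [] y, f, o⟩
      (2 * x.length + 2) := by
  have key : ∀ x : List CircuitSymbol, Runs (.loop Option.isSome (.read false))
      ⟨x.head?, stackPair false x.tail y, f, o⟩ ⟨none, stackPair false [] y, f, o⟩
        (2 * x.length + 1) := by
    intro x
    induction x with
    | nil => exact (Runs.loop_false rfl).cast rfl (by omega)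
    | cons a x ih =>
      exact (Runs.loop_true rfl ((Runs.read _ _).cast (by simp) le_rfl) ih).cast rfl
        (by rw [List.length_cons]; omega)
  exact (Runs.seq ((Runs.read _ _).cast (by simp) le_rfl) (key x)).cast rfl (by omega)

/-- The additional qubit is the scratch qubit 0. -/
theorem runs_writeTotal (n : ℕ) (v : Option CircuitSymbol) (src : Bool → List CircuitSymbol)
    (o : List ProgramSymbol) :
    Runs Prog.writeTotal ⟨v, src, counters 0 0 0 n, o⟩
      ⟨none, src, counters 0 0 0 0, ProgramSymbol.unary (n + 1) ++ o⟩ (3 * n + 7) := by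
  have key : ∀ (n : ℕ) (o : List ProgramSymbol),
      Runs (.loop Option.isSome (.seq (.emit .tick) (.dec .total)))
        ⟨if n = 0 then none else some .tick, src, counters 0 0 0 (n - 1), o⟩
        ⟨none, src, counters 0 0 0 0, List.replicate n .tick ++ o⟩ (3 * n + 1) := by
    intro n
    induction n with
    | zero =>
      intro o
      exact (Runs.loop_false rfl).cast rfl (by omega)
    | succ n ih =>
      intro o
      refine (Runs.loop_true rfl (.seq (.emit _ _) ((Runs.dec _ _).cast ?_ le_rfl))
        (ih (.tick :: o))).cast ?_ (by omega)
      · simp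
      · simp [List.replicate_succ']
  refine (Runs.seq (.inc _ _) (.seq (.emit _ _) (.seq ((Runs.dec _ _).cast ?_ le_rfl)
    (key (n + 1) (.sep :: o))))).cast ?_ (by omega)
  · simp
  · simp [ProgramSymbol.unary]

/-! ### Correctness of the compiler -/

/-- The gate acts on distinct qubits among `0, …, N`. -/
def WireGate.Valid (N : ℕ) : WireGate ℕ → Prop
  | .one _ q => q ≤ N
  | .csign a b => a ≤ N ∧ b ≤ N ∧ a ≠ b

/-- The machine writes natural numbers, whereas the circuit has qubits in `Fin (N + 1)`. For a valid
gate the reduction changes no number and no CSIGN is dropped, so both descriptions agree. -/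
theorem encode_toFin {N : ℕ} {g : WireGate ℕ} (h : g.Valid N) :
    (g.toFin N).toQGates.flatMap QGate.encode = g.encode := by
  cases g with
  | one u q =>
    have h : q ≤ N := h
    change QGate.encode (.one u (Fin.ofNat (N + 1) q)) ++ [] = _
    rw [List.append_nil, QGate.encode, ofNat_val h]
    rfl
  | csign a b =>
    obtain ⟨ha, hb, hab⟩ := h
    have hab' := ofNat_ne ha hb hab
    change List.flatMap _ (if h : Fin.ofNat (N + 1) a ≠ Fin.ofNat (N + 1) b then
      [QGate.csign _ _ h] else []) = _
    rw [dif_pos hab', List.flatMap_singleton, QGate.encode, ofNat_val ha, ofNat_val hb]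
    rfl

theorem encode_map_toFin {N : ℕ} {L : List (WireGate ℕ)} (h : ∀ g ∈ L, g.Valid N) :
    ((L.map (toFin N)).flatMap toQGates).flatMap QGate.encode = L.flatMap WireGate.encode := by
  induction L with
  | nil => rfl
  | cons g L ih =>
    rw [List.map_cons, List.flatMap_cons, List.flatMap_append, encode_toFin (h g (by simp)),
      ih fun g' hg' => h g' (by simp [hg']), List.flatMap_cons]

/-- Scratch is 0, inputs lie in 1, …, t and the target is t + 1, which separates every pair that
meets in a CSIGN. -/
theorem valid_blockAt {N t : ℕ} (g : BoolGate) (ht : t + 1 ≤ N) (hg : ∀ a ∈ g.inputs, a < t) :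
    ∀ u ∈ g.blockAt (t + 1), u.Valid N := by
  cases g with
  | const b =>
    cases b <;> simp [BoolGate.blockAt, BoolGate.block, WireGate.map, BoolGate.qubit, Valid]
    omega
  | not a =>
    simp only [BoolGate.inputs, List.mem_singleton, forall_eq] at hg
    simp [BoolGate.blockAt, BoolGate.block, cnot, WireGate.map, BoolGate.qubit, Valid,
      BoolGate.inputs]
    omega
  | and a b =>
    simp only [BoolGate.inputs, List.mem_cons, List.not_mem_nil, or_false, forall_eq_or_imp,
      forall_eq] at hg
    simp [BoolGate.blockAt, BoolGate.block, addMul, toffoli, ccsign, cnot, WireGate.map,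
      BoolGate.qubit, Valid, BoolGate.inputs]
    omega
  | or a b =>
    simp only [BoolGate.inputs, List.mem_cons, List.not_mem_nil, or_false, forall_eq_or_imp,
      forall_eq] at hg
    simp [BoolGate.blockAt, BoolGate.block, addMul, toffoli, ccsign, cnot, WireGate.map,
      BoolGate.qubit, Valid, BoolGate.inputs]
    omega

theorem valid_computeBlocks {N : ℕ} (gs : List BoolGate) (t : ℕ) (ht : t + gs.length ≤ N)
    (hgs : InputsPrecede t gs) : ∀ u ∈ computeBlocks (t + 1) gs, u.Valid N := by
  induction gs generalizing t with
  | nil => simp [computeBlocks]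
  | cons g gs ih =>
    rw [List.length_cons] at ht
    intro u hu
    rcases List.mem_append.mp hu with hu | hu
    · exact valid_blockAt g (by omega) hgs.head u hu
    · exact ih (t + 1) (by omega) hgs.tail u hu

theorem valid_uncomputeBlocks {N : ℕ} (gs : List BoolGate) (t : ℕ) (ht : t + gs.length ≤ N)
    (hgs : InputsPrecede t gs) : ∀ u ∈ uncomputeBlocks (t + 1) gs, u.Valid N := by
  induction gs generalizing t with
  | nil => simp [uncomputeBlocks]
  | cons g gs ih =>
    rw [List.length_cons] at ht
    intro u hu
    rcases List.mem_append.mp hu with hu | hu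
    · exact ih (t + 1) (by omega) hgs.tail u hu
    · exact valid_blockAt g (by omega) hgs.head u hu

theorem valid_hadamards {N n : ℕ} (h : n ≤ N) : ∀ u ∈ hadamards n, u.Valid N := by
  induction n with
  | zero => simp [hadamards]
  | succ n ih =>
    intro u hu
    rcases List.mem_append.mp hu with hu | hu
    · exact ih (by omega) u hu
    · rw [List.mem_singleton.mp hu]
      exact h

theorem valid_compiledGates {n : ℕ} (C : BoolCircuit n) :
    ∀ u ∈ C.compiledGates, u.Valid (n + C.gates.length) := by
  intro u hu
  simp only [BoolCircuit.compiledGates, List.mem_append, List.mem_singleton, List.mem_reverse]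
    at hu
  rcases hu with hu | hu | rfl | hu | hu
  · exact valid_hadamards (by omega) u hu
  · exact valid_computeBlocks C.gates n le_rfl C.gates_wf u hu
  · exact C.output_wf
  · exact valid_uncomputeBlocks C.gates n le_rfl C.gates_wf u hu
  · exact valid_hadamards (by omega) u hu

theorem encode_compile {n : ℕ} (C : BoolCircuit n) :
    C.compile.encode = ProgramSymbol.unary (n + C.gates.length + 1) ++
      C.compiledGates.flatMap WireGate.encode :=
  congrArg _ (encode_map_toFin (valid_compiledGates C))

theorem BoolGate.length_encode_le (g : BoolGate) {N : ℕ} (h : ∀ a ∈ g.inputs, a < N) :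
    g.encode.length ≤ 2 * N + 1 := by
  cases g <;> simp [BoolGate.encode, CircuitSymbol.unary, BoolGate.inputs] at h ⊢ <;> omega

theorem length_encode_gates_le (gs : List BoolGate) {N : ℕ}
    (h : ∀ g ∈ gs, ∀ a ∈ g.inputs, a < N) :
    (gs.flatMap BoolGate.encode).length ≤ gs.length * (2 * N + 1) := by
  induction gs with
  | nil => simp
  | cons g gs ih =>
    rw [List.flatMap_cons, List.length_append, List.length_cons, Nat.add_one_mul gs.length]
    have h1 := g.length_encode_le (h g (by simp))
    have h2 := ih fun g' hg' => h g' (by simp [hg'])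
    omega

theorem runs_compiler {n : ℕ} (C : BoolCircuit n) :
    Runs Prog.compiler ⟨none, stackPair false C.encode [], counters 0 0 0 0, []⟩
      ⟨none, stackPair false [] [], counters 0 0 0 0, C.compile.encode⟩
      (10000 * (n + C.size + 2) ^ 2) := by
  have hg : ∀ g ∈ C.gates, ∀ a ∈ g.inputs, a < n + C.gates.length + 1 := by
    intro g hg a ha
    obtain ⟨i, hi, rfl⟩ := List.getElem_of_mem hg
    have := C.gates_wf i hi a ha
    omega
  have hout := C.output_wf
  have h1 := runs_readInputs n (C.gates.flatMap BoolGate.encode ++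
    .out :: CircuitSymbol.unary C.output) [] [] (N := n + C.gates.length + 1) (by omega)
  have h2 := runs_forwardPass C.gates (N := n + C.gates.length + 1) (t := n + 1) (n := 0) none
    (CircuitSymbol.unary C.output) [] ((hadamards n).reverse.flatMap WireGate.encode ++ [])
    (by omega) (by omega) hg
  have h3 := runs_readOutput C.output (N := n + C.gates.length + 1) (some .tick) []
    (C.gates.reverse.flatMap BoolGate.encode ++ []) (t := n + C.gates.length) (n := 0)
    ((uncomputeBlocks (n + 1) C.gates).flatMap WireGate.encode ++
      ((hadamards n).reverse.flatMap WireGate.encode ++ [])) (by omega) (by omega) (by omega)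
  have h4 := runs_backwardPass C.gates (N := n + C.gates.length + 1) (t := n) (n := 0) none []
    (WireGate.encode (.one .Z (C.output + 1)) ++
      ((uncomputeBlocks (n + 1) C.gates).flatMap WireGate.encode ++
        ((hadamards n).reverse.flatMap WireGate.encode ++ []))) (by omega) (by omega) hg
  -- The backward pass names the second stack first; both its initial and its final store are
  -- brought to the common order.
  rw [stackPair_swap, stackPair_swap] at h4
  have h5 := runs_writeInputs n none
    (stackPair false (C.gates.flatMap BoolGate.encode ++ []) []) (0 + C.gates.length)
    ((computeBlocks (n + 1) C.gates).flatMap WireGate.encode ++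
      (WireGate.encode (.one .Z (C.output + 1)) ++
        ((uncomputeBlocks (n + 1) C.gates).flatMap WireGate.encode ++
          ((hadamards n).reverse.flatMap WireGate.encode ++ []))))
    (N := n + C.gates.length + 1) (by omega)
  have h6 := runs_clearInput (C.gates.flatMap BoolGate.encode ++ []) [] none
    (counters 0 0 0 (0 + C.gates.length + n)) ((hadamards n).flatMap WireGate.encode ++
      ((computeBlocks (n + 1) C.gates).flatMap WireGate.encode ++
        (WireGate.encode (.one .Z (C.output + 1)) ++
          ((uncomputeBlocks (n + 1) C.gates).flatMap WireGate.encode ++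
            ((hadamards n).reverse.flatMap WireGate.encode ++ [])))))
  have h7 := runs_writeTotal (0 + C.gates.length + n) none (stackPair false [] [])
    ((hadamards n).flatMap WireGate.encode ++
      ((computeBlocks (n + 1) C.gates).flatMap WireGate.encode ++
        (WireGate.encode (.one .Z (C.output + 1)) ++
          ((uncomputeBlocks (n + 1) C.gates).flatMap WireGate.encode ++
            ((hadamards n).reverse.flatMap WireGate.encode ++ [])))))
  -- The increment moves the target from the last input qubit to that of the first gate; the later
  -- decrement undoes the overshoot past the last gate.
  refine (Runs.seq h1 (.seq ((Runs.inc _ _).cast ?_ le_rfl) (.seq h2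
    (.seq ((Runs.dec _ _).cast ?_ le_rfl) (.seq (by simpa using h3)
      (.seq h4 (.seq h5 (.seq h6 h7)))))))).cast ?_ ?_
  · simp
  · simp
  · rw [encode_compile]
    simp [BoolCircuit.compiledGates, add_comm n]
  · have hlen := length_encode_gates_le C.gates hg
    simp only [List.append_nil, BoolCircuit.size]
    generalize (C.gates.flatMap BoolGate.encode).length = l at hlen ⊢
    generalize C.gates.length = m at hlen ⊢
    -- Each stage makes at most linearly many rounds of linear cost; clearing the input is bounded
    -- through the length of the gate descriptions.
    nlinarith

theorem lemma4 :
    ∃ (A : ∀ n : ℕ, BoolCircuit n → QProgram)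
      (M : Turing.TM2ComputableAux CircuitSymbol ProgramSymbol) (p : Polynomial ℕ),
      ∀ (n : ℕ) (C : BoolCircuit n),
        Nonempty (Turing.TM2OutputsInTime M.tm
          (C.encode.map M.inputAlphabet.symm)
          (some ((A n C).encode.map M.outputAlphabet.symm))
          (p.eval (n + C.size))) ∧
        (A n C).circuit.amplitude = (C.delta : ℂ) / 2 ^ n := by
  refine ⟨fun _ C => C.compile, Prog.compiler.computer, 10000 * (Polynomial.X + 2) ^ 2,
    fun n C => ⟨?_, compile_amplitude C⟩⟩
  have h := (runs_compiler C).cast (t' := (10000 * (Polynomial.X + 2) ^ 2 : Polynomial ℕ).eval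
    (n + C.size)) rfl (by simp)
  -- The stores are rewritten to the clean form that the machine's initial and halting
  -- configurations require.
  have hc : counters 0 0 0 0 = fun _ => 0 := by funext c; cases c <;> rfl
  have hs : stackPair false [] [] = fun _ => [] := by funext b; cases b <;> rfl
  rw [hc, hs] at h
  exact h.outputsInTime
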